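/- **Notation.** $\|\cdot\|$ is the spectral norm (Euclidean norm on vectors), $\|\cdot\|_F$ the Frobenius norm, $\mathrm{cond}(M)=\|M\|\,\|M^{-1}\|$, and $A\succeq B$ means that $A-B$ is positive semidefinite. $\Psi_n\in\mathbb R^{n^2\times n(n+1)/2}$ is the standard orthonormal basis matrix of the vectorized symmetric $n\times n$ matrices, $\mathrm{svec}(X)=\Psi_n^T\mathrm{vec}(X)$, and $A\otimes_s B=\tfrac12\Psi_n^T(A\otimes B+B\otimes A)\Psi_r$ for $A,B\in\mathbb R^{n\times r}$. Given $m\ge 1$ linearly independent symmetric $n\times n$ matrices $A_1,\dots,A_m$, let $\mathbf A=[\mathrm{svec}(A_1),\dots,\mathrm{svec}(A_m)]^T$. **Assumption 1.** $0<\mu\le 1$, $L\ge0$, $0\le\delta<1$, $\chi_1>0$, and $W=X^{1/2}(X^{1/2}SX^{1/2})^{-1/2}X^{1/2}$, where $X,S\succ0$ satisfy $$\left\|\tfrac1\mu X^{1/2}SX^{1/2}-I\right\|\le\delta,\qquad \|X-X^\star\|\le L\mu,\qquad \|S-S^\star\|\le L$$ for some $X^\star,S^\star\succeq0$ with $X^\star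 S^\star=0$ and $\chi_1^{-1}I\preceq X^\star+S^\star\preceq I$. **Assumption 2.** $X^\star=U^\star U^{\star T}$ with $U^\star\in\mathbb R^{n\times k}$ for some $k$, and $\chi_2\ge1$ satisfies $$\left\|(\mathbf A\mathbf A^T)^{-1/2}\mathbf A\,\mathrm{svec}(U^\star V^T+VU^{\star T})\right\|\ge\chi_2^{-1}\|U^\star V^T+VU^{\star T}\|_F\quad\text{for all }V\in\mathbb R^{n\times k}.$$ **Construction.** Let $\lambda_1(W)\ge\dots\ge\lambda_n(W)$ be the eigenvalues of $W$, take $\mathrm{rank}(X^\star)\le r<n$ and $\tau=\tfrac12\lambda_{r+1}(W)$, and write an orthonormal eigendecomposition $W=Q\Lambda Q^T+Q_\perp\Lambda_\perp Q_\perp^T$, where the diagonal matrix $\Lambda$ holds the top $r$ and $\Lambda_\perp$ the bottom $n-r$ eigenvalues. Put $$\mathbf Q=\left[Q\otimes_s Q,\ \sqrt2\,\Psi_n^T(Q\otimes Q_\perp)\right],\qquad \mathbf\Sigma=\mathrm{diag}\left(\Lambda\otimes_s\Lambda-\tau^2I,\ (\Lambda-\tau I)\otimes\Lambda_\perp\right)^{-1}.$$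 **Theorem 1 (Well-conditioning).** There is an absolute constant $K>0$ such that, whenever Assumptions 1 and 2 hold, $r,\tau,\mathbf Q,\mathbf\Sigma$ are as above, and $\mathbf G$ satisfies $\gamma_{\max}\mathbf A\mathbf A^T\succeq\mathbf G\succeq\gamma_{\min}\mathbf A\mathbf A^T$ with $\gamma_{\max}\ge\gamma_{\min}>0$, the augmented matrix is nonsingular and $$\mathrm{cond}\begin{bmatrix}\mathbf G&\mathbf A\mathbf Q\\ \mathbf Q^T\mathbf A^T&-\tau^2\mathbf\Sigma\end{bmatrix}\le K\cdot s\cdot\mathrm{cond}(\mathbf A\mathbf A^T)\cdot\gamma_{\max}^{4}\cdot\min\{1,\gamma_{\min}\}^{-8}\cdot\max\{1,L\}^{12}\cdot(1-\delta)^{-11}\cdot\chi_1^{2}\cdot\chi_2^{6},$$ where $s=\max\{1,\|\mathbf A\mathbf A^T\|^{-1}\}\cdot\max\{1,\|(\mathbf A\mathbf A^T)^{-1}\|^{-1}\}$. The constant $K$ does not depend on $\mu\in(0,1]$, nor on any other parameter, dimension or datum. In particular $s=1$ when $\mathbf A$ is scaled so that $\lambda_{\min}(\mathbf A\mathbf A^T)\le1\le\lambda_{\max}(\mathbf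 A\mathbf A^T)$; if moreover $L\ge1$ and $\gamma_{\min}\le1$, the condition number is $O\big(\mathrm{cond}(\mathbf A\mathbf A^T)\,\gamma_{\max}^{4}\,\gamma_{\min}^{-8}\,L^{12}\,(1-\delta)^{-11}\,\chi_1^{2}\,\chi_2^{6}\big)$. -/

import Mathlib

open Matrix
open scoped Kronecker MatrixOrder Matrix.Norms.L2Operator

noncomputable section

/-- Positions `(column, row)` in the lower triangle of an `n × n` matrix; there are `n(n+1)/2` of
them. They index the coordinates of a symmetric vectorization. -/
abbrev SymIdx (n : ℕ) : Type := {p : Fin n × Fin n // p.1 ≤ p.2}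

/-- The orthonormal basis matrix `Ψₙ` (of size `n² × n(n+1)/2`) of the vectorized symmetric
matrices. Its column at a diagonal position is a unit vector; its column at a position `(j, i)`,
`j < i`, has the two nonzero entries `1/√2` at `(j, i)` and `(i, j)`. -/
def symBasis (n : ℕ) : Matrix (Fin n × Fin n) (SymIdx n) ℝ :=
  Matrix.of fun p q =>
    if q.1.1 = q.1.2 then (if p = q.1 then 1 else 0)
    else (if p = q.1 ∨ p.swap = q.1 then (Real.sqrt 2)⁻¹ else 0)

/-- Symmetric vectorization `svec X = Ψₙᵀ vec X`, with the column-stacking `vec`. -/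
def svec {n : ℕ} (X : Matrix (Fin n) (Fin n) ℝ) : SymIdx n → ℝ :=
  (symBasis n)ᵀ *ᵥ Matrix.vec X

/-- Symmetric Kronecker product `A ⊗ₛ B = ½ Ψₙᵀ (A ⊗ B + B ⊗ A) Ψᵣ`. -/
def skron {n r : ℕ} (A B : Matrix (Fin n) (Fin r) ℝ) : Matrix (SymIdx n) (SymIdx r) ℝ :=
  (1 / 2 : ℝ) • ((symBasis n)ᵀ * (A ⊗ₖ B + B ⊗ₖ A) * symBasis r)

/-- Euclidean norm of a vector. -/
def euclNorm {ι : Type*} [Fintype ι] (v : ι → ℝ) : ℝ := ‖WithLp.toLp 2 v‖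

/-- Frobenius norm of a matrix. -/
def frobNorm {n : ℕ} (X : Matrix (Fin n) (Fin n) ℝ) : ℝ :=
  Real.sqrt (∑ i, ∑ j, X i j ^ 2)

/-- Condition number `‖M‖ ‖M⁻¹‖` in the spectral norm, meaningful for invertible `M`. -/
def condNumber {ι : Type*} [Fintype ι] [DecidableEq ι] (M : Matrix ι ι ℝ) : ℝ :=
  ‖M‖ * ‖M⁻¹‖

/-- The matrix `[svec A₁, …, svec Aₘ]ᵀ` of the operator `X ↦ (⟨A₁, X⟩, …, ⟨Aₘ, X⟩)`. -/
def constraintMatrix {n m : ℕ} (A : Fin m → Matrix (Fin n) (Fin n) ℝ) :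
    Matrix (Fin m) (SymIdx n) ℝ :=
  Matrix.of fun i => svec (A i)

/-- The Nesterov-Todd scaling point `X^{1/2} (X^{1/2} S X^{1/2})^{-1/2} X^{1/2}`. -/
def ntScaling {n : ℕ} (X S : Matrix (Fin n) (Fin n) ℝ) : Matrix (Fin n) (Fin n) ℝ :=
  CFC.sqrt X * (CFC.sqrt (CFC.sqrt X * S * CFC.sqrt X))⁻¹ * CFC.sqrt X

/-- Centrality and strict complementarity: `X`, `S` are `δ`-centered with duality gap parameter `μ`
and stay within `L μ`, `L` of a strictly complementary pair `Xs`, `Ss`, whose sum has its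
eigenvalues in `[1/χ₁, 1]`. -/
structure Centrality {n : ℕ} (μ L δ χ₁ : ℝ) (X S Xs Ss : Matrix (Fin n) (Fin n) ℝ) : Prop where
  L_nonneg : 0 ≤ L
  δ_nonneg : 0 ≤ δ
  δ_lt_one : δ < 1
  χ₁_pos : 0 < χ₁
  X_posDef : X.PosDef
  S_posDef : S.PosDef
  centered : ‖μ⁻¹ • (CFC.sqrt X * S * CFC.sqrt X) - 1‖ ≤ δ
  X_close : ‖X - Xs‖ ≤ L * μ
  S_close : ‖S - Ss‖ ≤ L
  Xs_posSemidef : Xs.PosSemidef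
  Ss_posSemidef : Ss.PosSemidef
  compl : Xs * Ss = 0
  strict_lower : (Xs + Ss - χ₁⁻¹ • (1 : Matrix (Fin n) (Fin n) ℝ)).PosSemidef
  upper : (1 - (Xs + Ss)).PosSemidef

/-- Tangent space injectivity at `Xs = Us Usᵀ`: for all `V`,
`‖(𝐀𝐀ᵀ)^{-1/2} 𝐀 svec(Us Vᵀ + V Usᵀ)‖ ≥ χ₂⁻¹ ‖Us Vᵀ + V Usᵀ‖_F`. -/
structure TangentInjectivity {n m k : ℕ} (χ₂ : ℝ) (A : Matrix (Fin m) (SymIdx n) ℝ)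
    (Xs : Matrix (Fin n) (Fin n) ℝ) (Us : Matrix (Fin n) (Fin k) ℝ) : Prop where
  one_le : 1 ≤ χ₂
  factor : Xs = Us * Usᵀ
  bound : ∀ V : Matrix (Fin n) (Fin k) ℝ,
    χ₂⁻¹ * frobNorm (Us * Vᵀ + V * Usᵀ) ≤
      euclNorm (((CFC.sqrt (A * Aᵀ))⁻¹ * A) *ᵥ svec (Us * Vᵀ + V * Usᵀ))

/-- `W = V diag(w) Vᵀ` is an orthonormal eigendecomposition with the eigenvalues in nonincreasing
order, so that `w i` is the `(i+1)`-st largest eigenvalue of `W` (indices start at `0`). -/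
structure IsOrderedEigendecomposition {n : ℕ} (W V : Matrix (Fin n) (Fin n) ℝ) (w : Fin n → ℝ) :
    Prop where
  orthonormal : Vᵀ * V = 1
  antitone : Antitone w
  eq : W = V * Matrix.diagonal w * Vᵀ

/-- The index of the `j`-th of the bottom `n - r` eigenvalues. -/
def botIdx {n r : ℕ} (j : Fin (n - r)) : Fin n := ⟨r + j, by omega⟩

/-- The columns `Q` of `V` for the top `r` eigenvalues. -/
def topVecs {n r : ℕ} (hr : r < n) (V : Matrix (Fin n) (Fin n) ℝ) : Matrix (Fin n) (Fin r) ℝ :=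
  V.submatrix id (Fin.castLE hr.le)

/-- The columns `Q⊥` of `V` for the bottom `n - r` eigenvalues. -/
def botVecs {n r : ℕ} (V : Matrix (Fin n) (Fin n) ℝ) : Matrix (Fin n) (Fin (n - r)) ℝ :=
  V.submatrix id botIdx

/-- The diagonal matrix `Λ` of the top `r` eigenvalues. -/
def topEig {n r : ℕ} (hr : r < n) (w : Fin n → ℝ) : Matrix (Fin r) (Fin r) ℝ :=
  Matrix.diagonal fun i => w (Fin.castLE hr.le i)

/-- The diagonal matrix `Λ⊥` of the bottom `n - r` eigenvalues. -/
def botEig {n r : ℕ} (w : Fin n → ℝ) : Matrix (Fin (n - r)) (Fin (n - r)) ℝ :=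
  Matrix.diagonal fun j => w (botIdx j)

/-- `𝐐 = [Q ⊗ₛ Q, √2 Ψₙᵀ (Q ⊗ Q⊥)]`. -/
def lowRankFactor {n r : ℕ} (hr : r < n) (V : Matrix (Fin n) (Fin n) ℝ) :
    Matrix (SymIdx n) (SymIdx r ⊕ (Fin r × Fin (n - r))) ℝ :=
  Matrix.fromCols (skron (topVecs hr V) (topVecs hr V))
    (Real.sqrt 2 • ((symBasis n)ᵀ * (topVecs hr V ⊗ₖ (botVecs V : Matrix _ (Fin (n - r)) ℝ))))

/-- `𝚺 = diag(Λ ⊗ₛ Λ - τ² I, (Λ - τ I) ⊗ Λ⊥)⁻¹`. -/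
def lowRankSigma {n r : ℕ} (hr : r < n) (w : Fin n → ℝ) (τ : ℝ) :
    Matrix (SymIdx r ⊕ (Fin r × Fin (n - r))) (SymIdx r ⊕ (Fin r × Fin (n - r))) ℝ :=
  (Matrix.fromBlocks (skron (topEig hr w) (topEig hr w) - τ ^ 2 • 1) 0 0
    ((topEig hr w - τ • 1) ⊗ₖ (botEig w : Matrix _ (Fin (n - r)) ℝ)))⁻¹

/-- The augmented matrix `[[G, 𝐀𝐐], [𝐐ᵀ𝐀ᵀ, -τ² 𝚺]]`. -/
def augmentedMatrix {n m r : ℕ} (hr : r < n) (A : Matrix (Fin m) (SymIdx n) ℝ)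
    (G : Matrix (Fin m) (Fin m) ℝ) (V : Matrix (Fin n) (Fin n) ℝ) (w : Fin n → ℝ) (τ : ℝ) :
    Matrix (Fin m ⊕ (SymIdx r ⊕ (Fin r × Fin (n - r))))
      (Fin m ⊕ (SymIdx r ⊕ (Fin r × Fin (n - r)))) ℝ :=
  Matrix.fromBlocks G (A * lowRankFactor hr V) ((lowRankFactor hr V)ᵀ * Aᵀ)
    (-(τ ^ 2 • lowRankSigma hr w τ))

/-- The scale factor `max{1, 1/‖𝐀𝐀ᵀ‖} · max{1, 1/‖(𝐀𝐀ᵀ)⁻¹‖}`; for a nonsingular Gram matrix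
`𝐀𝐀ᵀ` it is `1` exactly when `λ_min(𝐀𝐀ᵀ) ≤ 1 ≤ λ_max(𝐀𝐀ᵀ)`. -/
def scaleFactor {ι : Type*} [Fintype ι] [DecidableEq ι] (M : Matrix ι ι ℝ) : ℝ :=
  max 1 ‖M‖⁻¹ * max 1 ‖M⁻¹‖⁻¹

end

/-! Write M = 𝐀𝐀ᵀ, B = 𝐀𝐐 and D = τ²𝚺, so that the augmented matrix is [[G, B], [Bᵀ, -D]]. Since 𝐐
has orthonormal columns, the norm is at most ‖G‖ + 2‖B‖ + ‖D‖. For the inverse, let (f, g) be the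
image of (x, h). Pairing (x, h) with (f, -g) cancels the cross terms and bounds the energy xᵀGx +
hᵀDh by ‖(x, h)‖ ‖(f, g)‖. The form G controls x. Since Bh = f - Gx, control of h follows from a
coercivity estimate |h|² ≤ C (hᵀDh + |M^{-1/2}Bh|²); this is `euclNorm_le_saddlePoint`.

The heart is to obtain C independent of μ. Three facts about W are used. The identity WSW = X makes
every eigenvalue at least of order √μ (`eigenvalue_ge`). In the semidefinite order (1-δ)√μ W ⪯ X,
while the quadratic form of X is at most Lμ on the kernel of X*. Hence the (r+1)-st eigenvalue is
O(√μ) (`eigenvalue_le_of_rank_le`), and eigenvectors with eigenvalue above a cutoff T lie nearly in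
the range of X* (`spectralProj_mul_one_sub_le`).

With T a suitable multiple of √μ, the columns of 𝐐 are split by the larger eigenvalue of their pair
(`coercive_of_spectral_split`). If it is at most T, the entry of D is at least (τ/T)², which is
bounded below because τ and T are both of order √μ. If it exceeds T, the column belongs to a matrix
nearly tangent at X*, and tangent injectivity applies up to an error that is absorbed
(`coercive_of_near_tangent`). -/

/-! ### Euclidean and spectral norms, quadratic forms -/

section EuclideanNorm

variable {ι κ : Type*} [Fintype ι] [Fintype κ]

theorem euclNorm_nonneg (v : ι → ℝ) : 0 ≤ euclNorm v := norm_nonneg _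

theorem euclNorm_sq (v : ι → ℝ) : euclNorm v ^ 2 = v ⬝ᵥ v := by
  rw [euclNorm, EuclideanSpace.norm_sq_eq]
  simp [dotProduct, sq]

theorem dotProduct_self_nonneg_real (v : ι → ℝ) : 0 ≤ v ⬝ᵥ v := by
  rw [← euclNorm_sq]; positivity

theorem euclNorm_add_le (v w : ι → ℝ) : euclNorm (v + w) ≤ euclNorm v + euclNorm w := by
  simpa [euclNorm] using norm_add_le (WithLp.toLp 2 v) (WithLp.toLp 2 w)

theorem abs_dotProduct_le (v w : ι → ℝ) : |v ⬝ᵥ w| ≤ euclNorm v * euclNorm w := by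
  have h := abs_real_inner_le_norm (WithLp.toLp 2 w) (WithLp.toLp 2 v)
  rw [EuclideanSpace.inner_toLp_toLp] at h
  simpa [euclNorm, mul_comm, dotProduct_comm] using h

theorem euclNorm_le_of_sq_le {v : ι → ℝ} {c : ℝ} (hc : 0 ≤ c) (h : v ⬝ᵥ v ≤ c ^ 2) :
    euclNorm v ≤ c := by
  rw [← euclNorm_sq] at h
  exact le_of_sq_le_sq h hc

theorem euclNorm_elim_sq (v : ι → ℝ) (w : κ → ℝ) :
    euclNorm (Sum.elim v w) ^ 2 = v ⬝ᵥ v + w ⬝ᵥ w := by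
  simp [euclNorm_sq, dotProduct]

theorem dotProduct_sub_self_le (v w : ι → ℝ) :
    (v - w) ⬝ᵥ (v - w) ≤ 2 * (v ⬝ᵥ v) + 2 * (w ⬝ᵥ w) := by
  have h := dotProduct_self_nonneg_real (v + w)
  simp only [add_dotProduct, dotProduct_add, sub_dotProduct, dotProduct_sub] at *
  linarith

theorem mulVec_dotProduct_eq (M : Matrix ι κ ℝ) (v : κ → ℝ) (w : ι → ℝ) :
    (M *ᵥ v) ⬝ᵥ w = v ⬝ᵥ (Mᵀ *ᵥ w) := by
  rw [Matrix.dotProduct_mulVec, Matrix.vecMul_transpose]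

theorem euclNorm_mulVec_le [DecidableEq κ] (M : Matrix ι κ ℝ) (v : κ → ℝ) :
    euclNorm (M *ᵥ v) ≤ ‖M‖ * euclNorm v := by
  simpa [euclNorm] using Matrix.l2_opNorm_mulVec M (WithLp.toLp 2 v)

theorem opNorm_le_of_euclNorm_le [DecidableEq κ] {M : Matrix ι κ ℝ} {c : ℝ} (hc : 0 ≤ c)
    (h : ∀ v, euclNorm (M *ᵥ v) ≤ c * euclNorm v) : ‖M‖ ≤ c := by
  rw [Matrix.l2_opNorm_def]
  refine ContinuousLinearMap.opNorm_le_bound _ hc fun x => ?_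
  exact h x.ofLp

theorem opNorm_sq_le_of_dotProduct_le [DecidableEq κ] {M : Matrix ι κ ℝ} {c : ℝ} (hc : 0 ≤ c)
    (h : ∀ v, (M *ᵥ v) ⬝ᵥ (M *ᵥ v) ≤ c * (v ⬝ᵥ v)) : ‖M‖ ^ 2 ≤ c := by
  have : ‖M‖ ≤ √c := by
    refine opNorm_le_of_euclNorm_le (Real.sqrt_nonneg _) fun v => ?_
    refine euclNorm_le_of_sq_le (mul_nonneg (Real.sqrt_nonneg _) (euclNorm_nonneg _)) ?_
    rw [mul_pow, Real.sq_sqrt hc, euclNorm_sq]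
    exact h v
  calc ‖M‖ ^ 2 ≤ √c ^ 2 := pow_le_pow_left₀ (norm_nonneg _) this 2
    _ = c := Real.sq_sqrt hc

theorem mulVec_dotProduct_self_le [DecidableEq κ] (M : Matrix ι κ ℝ) (v : κ → ℝ) :
    (M *ᵥ v) ⬝ᵥ (M *ᵥ v) ≤ ‖M‖ ^ 2 * (v ⬝ᵥ v) := by
  rw [← euclNorm_sq, ← euclNorm_sq, ← mul_pow]
  exact pow_le_pow_left₀ (euclNorm_nonneg _) (euclNorm_mulVec_le M v) 2

theorem abs_quadForm_le [DecidableEq ι] (M : Matrix ι ι ℝ) (v : ι → ℝ) :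
    |v ⬝ᵥ M *ᵥ v| ≤ ‖M‖ * (v ⬝ᵥ v) := by
  refine (abs_dotProduct_le _ _).trans ?_
  rw [← euclNorm_sq]
  nlinarith [mul_le_mul_of_nonneg_left (euclNorm_mulVec_le M v) (euclNorm_nonneg v)]

theorem opNorm_transpose [DecidableEq ι] [DecidableEq κ] (M : Matrix ι κ ℝ) : ‖Mᵀ‖ = ‖M‖ := by
  rw [← Matrix.conjTranspose_eq_transpose_of_trivial, Matrix.l2_opNorm_conjTranspose]

theorem opNorm_mul_transpose_self [DecidableEq ι] [DecidableEq κ] (M : Matrix ι κ ℝ) :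
    ‖M * Mᵀ‖ = ‖M‖ ^ 2 := by
  have h := Matrix.l2_opNorm_conjTranspose_mul_self Mᵀ
  rwa [Matrix.conjTranspose_eq_transpose_of_trivial, Matrix.transpose_transpose,
    opNorm_transpose, ← sq] at h

theorem quadForm_nonneg {M : Matrix ι ι ℝ} (hM : M.PosSemidef) (v : ι → ℝ) :
    0 ≤ v ⬝ᵥ M *ᵥ v := by
  simpa using hM.dotProduct_mulVec_nonneg v

theorem quadForm_le_of_sub_posSemidef {M N : Matrix ι ι ℝ} (h : (N - M).PosSemidef)
    (v : ι → ℝ) : v ⬝ᵥ M *ᵥ v ≤ v ⬝ᵥ N *ᵥ v := by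
  have := quadForm_nonneg h v
  rw [Matrix.sub_mulVec, dotProduct_sub] at this
  linarith

theorem transpose_eq_of_isHermitian {ι : Type*} {M : Matrix ι ι ℝ} (h : M.IsHermitian) : Mᵀ = M := by
  rw [← Matrix.conjTranspose_eq_transpose_of_trivial, h.eq]

/-- Cauchy-Schwarz for a positive semidefinite form, applied to `v` and `M v`. -/
theorem mulVec_dotProduct_self_le_of_posSemidef [DecidableEq ι] {M : Matrix ι ι ℝ}
    (hM : M.PosSemidef) {c : ℝ} (hc : ∀ v, v ⬝ᵥ M *ᵥ v ≤ c * (v ⬝ᵥ v)) (v : ι → ℝ) :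
    (M *ᵥ v) ⬝ᵥ (M *ᵥ v) ≤ c * (v ⬝ᵥ M *ᵥ v) := by
  have hs := CFC.sqrt_mul_sqrt_self M (Matrix.nonneg_iff_posSemidef.2 hM)
  have ht : (CFC.sqrt M)ᵀ = CFC.sqrt M :=
    transpose_eq_of_isHermitian (Matrix.nonneg_iff_posSemidef.1 (CFC.sqrt_nonneg M)).1
  have key : ∀ u, u ⬝ᵥ M *ᵥ u = (CFC.sqrt M *ᵥ u) ⬝ᵥ (CFC.sqrt M *ᵥ u) := fun u => by
    rw [mulVec_dotProduct_eq, ht, Matrix.mulVec_mulVec, hs]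
  have h1 := hc (CFC.sqrt M *ᵥ v)
  rw [key, ← key v, Matrix.mulVec_mulVec, hs] at h1
  exact h1

end EuclideanNorm

/-! ### Symmetric vectorization, Frobenius norm and symmetric Kronecker products -/

section SymmetricVectorization

/-- The symmetric matrix with a given symmetric vectorization. -/
noncomputable def smat {n : ℕ} (x : SymIdx n → ℝ) : Matrix (Fin n) (Fin n) ℝ :=
  Matrix.of fun a b => (symBasis n *ᵥ x) (b, a)

/-- Square of the Frobenius norm. -/
noncomputable def frobSq {m n : ℕ} (X : Matrix (Fin m) (Fin n) ℝ) : ℝ := ∑ i, ∑ j, X i j ^ 2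

/-- A column of Ψ has one nonzero entry, or two equal ones at swapped positions, so sums against it
collapse. -/
theorem sum_mul_symBasis {n : ℕ} (f : Fin n × Fin n → ℝ) (q : SymIdx n) :
    ∑ p, f p * symBasis n p q =
      if q.1.1 = q.1.2 then f q.1 else (√2)⁻¹ * (f q.1 + f q.1.swap) := by
  obtain ⟨⟨i, j⟩, hij⟩ := q
  by_cases h : i = j
  · simp [symBasis, h]
  · have h1 : ∀ p : Fin n × Fin n, f p * symBasis n p ⟨(i, j), hij⟩ =
        (√2)⁻¹ * ((if p = (i, j) then f p else 0) + (if p = (j, i) then f p else 0)) := by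
      rintro ⟨a, b⟩
      simp only [symBasis, Matrix.of_apply, h, if_false, Prod.swap_prod_mk, Prod.mk.injEq]
      by_cases h1 : a = i ∧ b = j
      · have : ¬ (a = j ∧ b = i) := fun h2 => h (h1.1.symm.trans h2.1)
        simp [h1.1, h1.2, h, mul_comm]
      · by_cases h2 : a = j ∧ b = i
        · simp [h2.1, h2.2, h, Ne.symm h, mul_comm]
        · have h3 : ¬ (b = i ∧ a = j) := fun h3 => h2 ⟨h3.2, h3.1⟩
          simp [h1, h2, h3]
    simp only [h1, ← Finset.mul_sum, Finset.sum_add_distrib, Finset.sum_ite_eq',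
      Finset.mem_univ, if_true, h, if_false, Prod.swap_prod_mk]

theorem symBasis_swap {n : ℕ} (p : Fin n × Fin n) (q : SymIdx n) :
    symBasis n p.swap q = symBasis n p q := by
  obtain ⟨⟨i, j⟩, hij⟩ := q
  obtain ⟨a, b⟩ := p
  by_cases h : i = j
  · subst h
    simp [symBasis, and_comm]
  · simp [symBasis, h, or_comm]

theorem symBasis_transpose_mul_self (n : ℕ) : (symBasis n)ᵀ * symBasis n = 1 := by
  ext p q
  rw [Matrix.mul_apply]
  simp only [Matrix.transpose_apply]
  rw [sum_mul_symBasis (fun a => symBasis n a p) q, symBasis_swap]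
  obtain ⟨⟨i, j⟩, hij⟩ := q
  obtain ⟨⟨a, b⟩, hab⟩ := p
  have hs : (√2)⁻¹ * ((√2)⁻¹ + (√2)⁻¹) = 1 := by
    have : (√2)⁻¹ * (√2)⁻¹ = 1 / 2 := by
      rw [← mul_inv, Real.mul_self_sqrt (by norm_num)]; norm_num
    linarith
  simp only [symBasis, Matrix.of_apply, Matrix.one_apply, Subtype.mk.injEq, Prod.mk.injEq,
    Prod.swap_prod_mk] at *
  by_cases h1 : i = j
  · by_cases h2 : a = b
    · simp [h1, h2, eq_comm]
    · have : ¬ (j = a ∧ j = b) := fun h => h2 (h.1.symm.trans h.2)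
      have h3 : ¬ (a = j ∧ b = j) := fun h => h2 (h.1.trans h.2.symm)
      simp [h1, h2, this, h3]
  · by_cases h2 : a = b
    · have : ¬ (i = b ∧ j = b) := fun h => h1 (h.1.trans h.2.symm)
      have h3 : ¬ (b = i ∧ b = j) := fun h => h1 (h.1.symm.trans h.2)
      simp [h1, h2, this, h3]
    · by_cases h3 : a = i ∧ b = j
      · obtain ⟨rfl, rfl⟩ := h3
        simp [h1, hs]
      · have h4 : ¬ (i = a ∧ j = b) := fun h => h3 ⟨h.1.symm, h.2.symm⟩
        -- Each unordered pair is listed once, with its smaller index first, so a swapped match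
        -- would force i = j.
        have h5 : ¬ (j = a ∧ i = b) := fun h => h1 (le_antisymm hij
          (by rw [h.1, h.2]; exact hab))
        simp [h1, h2, h3, h4, h5]

theorem smat_transpose {n : ℕ} (x : SymIdx n → ℝ) : (smat x)ᵀ = smat x := by
  ext a b
  simp only [smat, Matrix.transpose_apply, Matrix.of_apply, Matrix.mulVec, dotProduct]
  exact Finset.sum_congr rfl fun q _ => by rw [← symBasis_swap (a, b) q]; rfl

theorem vec_smat {n : ℕ} (x : SymIdx n → ℝ) : (smat x).vec = symBasis n *ᵥ x := rfl

theorem svec_smat {n : ℕ} (x : SymIdx n → ℝ) : svec (smat x) = x := by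
  rw [svec, vec_smat, Matrix.mulVec_mulVec, symBasis_transpose_mul_self, Matrix.one_mulVec]

theorem smat_add {n : ℕ} (x y : SymIdx n → ℝ) : smat (x + y) = smat x + smat y := by
  ext a b; simp [smat, Matrix.mulVec_add]

theorem svec_add {n : ℕ} (X Y : Matrix (Fin n) (Fin n) ℝ) : svec (X + Y) = svec X + svec Y := by
  rw [svec, Matrix.vec_add, Matrix.mulVec_add]; rfl

theorem svec_smul {n : ℕ} (c : ℝ) (X : Matrix (Fin n) (Fin n) ℝ) :
    svec (c • X) = c • svec X := by
  rw [svec, Matrix.vec_smul, Matrix.mulVec_smul]; rfl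

theorem svec_apply {n : ℕ} {X : Matrix (Fin n) (Fin n) ℝ} (hX : Xᵀ = X) (q : SymIdx n) :
    svec X q = (if q.1.1 = q.1.2 then 1 else √2) * X q.1.1 q.1.2 := by
  have hs : ∀ a b, X a b = X b a := fun a b => by conv_lhs => rw [← hX, Matrix.transpose_apply]
  simp only [svec, Matrix.mulVec, dotProduct, Matrix.transpose_apply]
  simp only [mul_comm (symBasis n _ q)]
  rw [sum_mul_symBasis X.vec q]
  obtain ⟨⟨i, j⟩, hij⟩ := q
  by_cases h : i = j
  · simp [h, Matrix.vec]
  · simp only [h, if_false, Matrix.vec, Prod.swap_prod_mk, hs j i]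
    have : (√2)⁻¹ * 2 = √2 := by
      rw [inv_mul_eq_div, Real.div_sqrt]
    linear_combination (X i j) * this

theorem smat_apply_of_le {n : ℕ} (x : SymIdx n → ℝ) (q : SymIdx n) :
    x q = (if q.1.1 = q.1.2 then 1 else √2) * smat x q.1.1 q.1.2 := by
  conv_lhs => rw [← svec_smat x]
  exact svec_apply (smat_transpose x) q

theorem eq_of_svec_eq {n : ℕ} {X Y : Matrix (Fin n) (Fin n) ℝ} (hX : Xᵀ = X) (hY : Yᵀ = Y)
    (h : svec X = svec Y) : X = Y := by
  have key : ∀ a b, a ≤ b → X a b = Y a b := fun a b hab => by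
    have := congrFun h ⟨(a, b), hab⟩
    rw [svec_apply hX, svec_apply hY] at this
    refine mul_left_cancel₀ ?_ this
    split_ifs <;> positivity
  ext a b
  rcases le_total a b with hab | hab
  · exact key a b hab
  · rw [← hX, ← hY]; exact key b a hab

theorem smat_svec {n : ℕ} {X : Matrix (Fin n) (Fin n) ℝ} (hX : Xᵀ = X) : smat (svec X) = X :=
  eq_of_svec_eq (smat_transpose _) hX (svec_smat _)

theorem frobSq_smat {n : ℕ} (x : SymIdx n → ℝ) : frobSq (smat x) = x ⬝ᵥ x := by
  have h1 : frobSq (smat x) = (symBasis n *ᵥ x) ⬝ᵥ (symBasis n *ᵥ x) := by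
    rw [← vec_smat, frobSq, dotProduct, Fintype.sum_prod_type, Finset.sum_comm]
    simp [Matrix.vec, sq]
  rw [h1, mulVec_dotProduct_eq, Matrix.mulVec_mulVec, symBasis_transpose_mul_self,
    Matrix.one_mulVec]

theorem svec_dotProduct_self {n : ℕ} {X : Matrix (Fin n) (Fin n) ℝ} (hX : Xᵀ = X) :
    svec X ⬝ᵥ svec X = frobSq X := by
  rw [← frobSq_smat, smat_svec hX]

theorem frobNorm_sq {n : ℕ} (X : Matrix (Fin n) (Fin n) ℝ) : frobNorm X ^ 2 = frobSq X := by
  rw [frobNorm, Real.sq_sqrt (by positivity), frobSq]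

theorem frobSq_nonneg {m n : ℕ} (X : Matrix (Fin m) (Fin n) ℝ) : 0 ≤ frobSq X := by
  unfold frobSq; positivity

theorem frobSq_transpose {m n : ℕ} (X : Matrix (Fin m) (Fin n) ℝ) : frobSq Xᵀ = frobSq X := by
  unfold frobSq; rw [Finset.sum_comm]; rfl

theorem frobSq_add_le {m n : ℕ} (X Y : Matrix (Fin m) (Fin n) ℝ) :
    frobSq (X + Y) ≤ 2 * frobSq X + 2 * frobSq Y := by
  simp only [frobSq, Finset.mul_sum, ← Finset.sum_add_distrib]
  refine Finset.sum_le_sum fun i _ => Finset.sum_le_sum fun j _ => ?_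
  rw [Matrix.add_apply]
  nlinarith [sq_nonneg (X i j - Y i j)]

theorem frobSq_eq_sum_col {m n : ℕ} (X : Matrix (Fin m) (Fin n) ℝ) :
    frobSq X = ∑ j, (fun i => X i j) ⬝ᵥ (fun i => X i j) := by
  rw [← frobSq_transpose]; simp [frobSq, dotProduct, sq]

theorem frobSq_mul_le {l m n : ℕ} (A : Matrix (Fin l) (Fin m) ℝ) (X : Matrix (Fin m) (Fin n) ℝ) :
    frobSq (A * X) ≤ ‖A‖ ^ 2 * frobSq X := by
  rw [frobSq_eq_sum_col, frobSq_eq_sum_col, Finset.mul_sum]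
  refine Finset.sum_le_sum fun j _ => ?_
  exact mulVec_dotProduct_self_le A (fun i => X i j)

theorem frobSq_mul_le' {l m n : ℕ} (X : Matrix (Fin l) (Fin m) ℝ) (A : Matrix (Fin m) (Fin n) ℝ) :
    frobSq (X * A) ≤ ‖A‖ ^ 2 * frobSq X := by
  rw [← frobSq_transpose, Matrix.transpose_mul, ← opNorm_transpose, ← frobSq_transpose X]
  exact frobSq_mul_le _ _

theorem frobSq_orthogonal_mul {l m n : ℕ} {V : Matrix (Fin l) (Fin m) ℝ} (hV : Vᵀ * V = 1)
    (X : Matrix (Fin m) (Fin n) ℝ) : frobSq (V * X) = frobSq X := by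
  rw [frobSq_eq_sum_col, frobSq_eq_sum_col]
  refine Finset.sum_congr rfl fun j _ => ?_
  change (V *ᵥ fun i => X i j) ⬝ᵥ (V *ᵥ fun i => X i j) = _
  rw [mulVec_dotProduct_eq, Matrix.mulVec_mulVec, hV, Matrix.one_mulVec]

theorem frobSq_orthogonal_conj {m n : ℕ} {V : Matrix (Fin m) (Fin n) ℝ} (hV : Vᵀ * V = 1)
    (X : Matrix (Fin n) (Fin n) ℝ) : frobSq (V * X * Vᵀ) = frobSq X := by
  rw [Matrix.mul_assoc, frobSq_orthogonal_mul hV, ← frobSq_transpose, Matrix.transpose_mul,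
    Matrix.transpose_transpose, frobSq_orthogonal_mul hV, frobSq_transpose]

theorem skron_self_eq {n r : ℕ} (A : Matrix (Fin n) (Fin r) ℝ) :
    skron A A = (symBasis n)ᵀ * (A ⊗ₖ A) * symBasis r := by
  rw [skron, ← two_smul ℝ (A ⊗ₖ A), Matrix.mul_smul, Matrix.smul_mul, smul_smul]
  norm_num

theorem skron_self_mulVec {n r : ℕ} (A : Matrix (Fin n) (Fin r) ℝ) (x : SymIdx r → ℝ) :
    skron A A *ᵥ x = svec (A * smat x * Aᵀ) := by
  rw [skron_self_eq, ← Matrix.mulVec_mulVec, ← Matrix.mulVec_mulVec, ← vec_smat,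
    Matrix.kronecker_mulVec_vec, svec]

/-- The diagonal matrix Λ ⊗ Λ scales the positions (i, j) and (j, i) alike, so every column of Ψ is
an eigenvector. This is what makes 𝚺 diagonal. -/
theorem skron_diagonal {n : ℕ} (w : Fin n → ℝ) :
    skron (Matrix.diagonal w) (Matrix.diagonal w) =
      Matrix.diagonal fun q : SymIdx n => w q.1.1 * w q.1.2 := by
  have h : (Matrix.diagonal w ⊗ₖ Matrix.diagonal w) * symBasis n =
      symBasis n * Matrix.diagonal fun q : SymIdx n => w q.1.1 * w q.1.2 := by
    rw [Matrix.diagonal_kronecker_diagonal]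
    ext ⟨a, b⟩ ⟨⟨i, j⟩, hij⟩
    rw [Matrix.diagonal_mul, Matrix.mul_diagonal]
    simp only [symBasis, Matrix.of_apply, Prod.swap_prod_mk, Prod.mk.injEq]
    split_ifs with h1 h2 h3
    · rw [h2.1, h2.2]; ring
    · simp
    · rcases h3 with h3 | h3
      · rw [h3.1, h3.2]; ring
      · rw [h3.1, h3.2]; ring
    · simp
  rw [skron_self_eq, Matrix.mul_assoc, h, ← Matrix.mul_assoc, symBasis_transpose_mul_self,
    Matrix.one_mul]

end SymmetricVectorization

/-! ### The factor 𝐐 as a set of columns of V ⊗ₛ V -/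

section LowRankFactor

/-- Index type of the columns of `lowRankFactor`. -/
abbrev LowRankIdx (n r : ℕ) : Type := SymIdx r ⊕ (Fin r × Fin (n - r))

/-- The pair of eigenvalue indices belonging to a column of `lowRankFactor`. -/
def pairIdx {n r : ℕ} (hr : r < n) : LowRankIdx n r → SymIdx n
  | Sum.inl q => ⟨(Fin.castLE hr.le q.1.1, Fin.castLE hr.le q.1.2), q.2⟩
  | Sum.inr p => ⟨(Fin.castLE hr.le p.1, botIdx p.2), by
      have := p.1.2
      simp only [botIdx, Fin.le_def, Fin.val_castLE]; omega⟩

theorem pairIdx_injective {n r : ℕ} (hr : r < n) : Function.Injective (pairIdx hr) := by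
  rintro (⟨⟨a, b⟩, hab⟩ | ⟨a, b⟩) (⟨⟨c, d⟩, hcd⟩ | ⟨c, d⟩) h
  all_goals simp only [pairIdx, botIdx, Subtype.mk.injEq, Prod.mk.injEq, Fin.ext_iff,
    Fin.val_castLE] at h
  · simp [Fin.ext_iff, h.1, h.2]
  · have := b.2; omega
  · have := d.2; omega
  · simp [Fin.ext_iff, h.1]; omega

/-- Both blocks of 𝐐 consist of columns of the one matrix V ⊗ₛ V. This gives orthonormality at once
and lets the two blocks be treated uniformly. -/
theorem lowRankFactor_eq {n r : ℕ} (hr : r < n) (V : Matrix (Fin n) (Fin n) ℝ) :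
    lowRankFactor hr V = (skron V V).submatrix id (pairIdx hr) := by
  have hcol : ∀ (l : ℕ) (B : Matrix (Fin n) (Fin l) ℝ) (a : Fin n × Fin n) (q : SymIdx l),
      ((B ⊗ₖ B) * symBasis l) a q =
        if q.1.1 = q.1.2 then B a.1 q.1.1 * B a.2 q.1.2
        else (√2)⁻¹ * (B a.1 q.1.1 * B a.2 q.1.2 + B a.1 q.1.2 * B a.2 q.1.1) := by
    intro l B a q
    rw [Matrix.mul_apply, sum_mul_symBasis (fun p => (B ⊗ₖ B) a p) q]
    rfl
  ext p (q | ⟨i, j⟩)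
  · rw [lowRankFactor, Matrix.fromCols_apply_inl, Matrix.submatrix_apply, skron_self_eq,
      skron_self_eq, Matrix.mul_assoc, Matrix.mul_assoc, Matrix.mul_apply, Matrix.mul_apply]
    refine Finset.sum_congr rfl fun a _ => ?_
    rw [hcol, hcol]
    simp [pairIdx, topVecs, Fin.ext_iff]
  · rw [lowRankFactor, Matrix.fromCols_apply_inr, Matrix.submatrix_apply, skron_self_eq,
      Matrix.mul_assoc, Matrix.smul_apply, Matrix.mul_apply, Matrix.mul_apply]
    have hne : (Fin.castLE hr.le i : Fin n) ≠ botIdx j := by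
      have := i.2
      simp only [botIdx, ne_eq, Fin.ext_iff, Fin.val_castLE]; omega
    have h1 : ∀ a : Fin n × Fin n, ((V ⊗ₖ V) * symBasis n) a (pairIdx hr (Sum.inr (i, j))) =
        (√2)⁻¹ * (V a.1 (Fin.castLE hr.le i) * V a.2 (botIdx j) +
          V a.1 (botIdx j) * V a.2 (Fin.castLE hr.le i)) := fun a => by
      rw [hcol]; simp [pairIdx, hne]
    simp only [h1]
    set f : Fin n × Fin n → ℝ := fun a => V a.1 (Fin.castLE hr.le i) * V a.2 (botIdx j) with hf
    -- Ψᵀ does not distinguish v ⊗ u from u ⊗ v, so the two symmetrized terms agree and (√2)⁻¹ · 2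
    -- gives the factor √2 of the mixed block.
    have h2 : ∑ a, symBasis n a p * f a.swap = ∑ a, symBasis n a p * f a := by
      rw [← Equiv.sum_comp (Equiv.prodComm (Fin n) (Fin n))]
      refine Finset.sum_congr rfl fun a _ => ?_
      simp only [Equiv.prodComm_apply, Prod.swap_swap, symBasis_swap]
    have h3 : ∀ a : Fin n × Fin n, (symBasis n)ᵀ (id p) a * ((√2)⁻¹ *
        (V a.1 (Fin.castLE hr.le i) * V a.2 (botIdx j) +
          V a.1 (botIdx j) * V a.2 (Fin.castLE hr.le i))) =
        (√2)⁻¹ * (symBasis n a p * f a + symBasis n a p * f a.swap) := fun a => by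
      simp only [hf, Matrix.transpose_apply, id, Prod.fst_swap, Prod.snd_swap]; ring
    simp only [h3, ← Finset.mul_sum, Finset.sum_add_distrib, h2]
    have h4 : ∑ a, (symBasis n)ᵀ p a * (topVecs hr V ⊗ₖ (botVecs V : Matrix _ (Fin (n - r)) ℝ)) a
        (i, j) = ∑ a, symBasis n a p * f a := rfl
    rw [h4, ← two_mul, ← mul_assoc, inv_mul_eq_div, Real.div_sqrt, smul_eq_mul]

/-- Extension by zero along `pairIdx`. -/
noncomputable def extendPair {n r : ℕ} (hr : r < n) (h : LowRankIdx n r → ℝ) : SymIdx n → ℝ :=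
  Function.extend (pairIdx hr) h 0

theorem extendPair_apply {n r : ℕ} (hr : r < n) (h : LowRankIdx n r → ℝ) (j : LowRankIdx n r) :
    extendPair hr h (pairIdx hr j) = h j := (pairIdx_injective hr).extend_apply _ _ _

theorem sum_mul_extendPair {n r : ℕ} (hr : r < n) (f : SymIdx n → ℝ) (h : LowRankIdx n r → ℝ) :
    ∑ q, f q * extendPair hr h q = ∑ j, f (pairIdx hr j) * h j := by
  symm
  refine Fintype.sum_of_injective (pairIdx hr) (pairIdx_injective hr) _ _ (fun q hq => ?_)
    fun j => by rw [extendPair_apply]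
  rw [extendPair, Function.extend_apply' _ _ _ (by simpa using hq)]
  simp

theorem extendPair_dotProduct_self {n r : ℕ} (hr : r < n) (h : LowRankIdx n r → ℝ) :
    extendPair hr h ⬝ᵥ extendPair hr h = h ⬝ᵥ h := by
  rw [dotProduct, sum_mul_extendPair]
  simp [extendPair_apply, dotProduct]

/-- The symmetric matrix with symmetric vectorization `lowRankFactor hr V *ᵥ h`. -/
noncomputable def lowRankMat {n r : ℕ} (hr : r < n) (V : Matrix (Fin n) (Fin n) ℝ) (h : LowRankIdx n r → ℝ) :
    Matrix (Fin n) (Fin n) ℝ := V * smat (extendPair hr h) * Vᵀ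

theorem lowRankMat_transpose {n r : ℕ} (hr : r < n) (V : Matrix (Fin n) (Fin n) ℝ)
    (h : LowRankIdx n r → ℝ) : (lowRankMat hr V h)ᵀ = lowRankMat hr V h := by
  simp [lowRankMat, Matrix.transpose_mul, smat_transpose, Matrix.mul_assoc]

theorem lowRankFactor_mulVec {n r : ℕ} (hr : r < n) (V : Matrix (Fin n) (Fin n) ℝ)
    (h : LowRankIdx n r → ℝ) : lowRankFactor hr V *ᵥ h = svec (lowRankMat hr V h) := by
  rw [lowRankMat, ← skron_self_mulVec, lowRankFactor_eq]
  ext p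
  simp only [Matrix.mulVec, dotProduct, Matrix.submatrix_apply, id]
  rw [sum_mul_extendPair hr (fun q => skron V V p q)]

theorem frobSq_lowRankMat {n r : ℕ} (hr : r < n) {V : Matrix (Fin n) (Fin n) ℝ}
    (hV : Vᵀ * V = 1) (h : LowRankIdx n r → ℝ) : frobSq (lowRankMat hr V h) = h ⬝ᵥ h := by
  rw [lowRankMat, frobSq_orthogonal_conj hV, frobSq_smat, extendPair_dotProduct_self]

theorem lowRankFactor_mulVec_dotProduct_self {n r : ℕ} (hr : r < n)
    {V : Matrix (Fin n) (Fin n) ℝ} (hV : Vᵀ * V = 1) (h : LowRankIdx n r → ℝ) :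
    (lowRankFactor hr V *ᵥ h) ⬝ᵥ (lowRankFactor hr V *ᵥ h) = h ⬝ᵥ h := by
  rw [lowRankFactor_mulVec, svec_dotProduct_self (lowRankMat_transpose hr V h),
    frobSq_lowRankMat hr hV]

end LowRankFactor

/-! ### Orthogonal projections and compression -/

section OrthogonalProjection

variable {n : ℕ}

theorem projection_dotProduct_self_le {P : Matrix (Fin n) (Fin n) ℝ} (hs : Pᵀ = P)
    (hi : P * P = P) (v : Fin n → ℝ) : (P *ᵥ v) ⬝ᵥ (P *ᵥ v) ≤ v ⬝ᵥ v := by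
  have h1 : (P *ᵥ v) ⬝ᵥ (P *ᵥ v) = v ⬝ᵥ P *ᵥ v := by
    rw [mulVec_dotProduct_eq, hs, Matrix.mulVec_mulVec, hi]
  have h2 := dotProduct_self_nonneg_real (v - P *ᵥ v)
  simp only [sub_dotProduct, dotProduct_sub, h1] at h2
  rw [dotProduct_comm (P *ᵥ v) v] at h2
  linarith

theorem projection_opNorm_sq_le {P : Matrix (Fin n) (Fin n) ℝ} (hs : Pᵀ = P)
    (hi : P * P = P) : ‖P‖ ^ 2 ≤ 1 :=
  opNorm_sq_le_of_dotProduct_le zero_le_one fun v => by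
    simpa using projection_dotProduct_self_le hs hi v

theorem one_sub_projection_transpose {P : Matrix (Fin n) (Fin n) ℝ} (hs : Pᵀ = P) :
    (1 - P)ᵀ = 1 - P := by simp [hs]

theorem one_sub_projection_mul_self {P : Matrix (Fin n) (Fin n) ℝ} (hi : P * P = P) :
    (1 - P) * (1 - P) = 1 - P := by
  rw [Matrix.mul_sub, Matrix.sub_mul, Matrix.sub_mul, hi]; simp

/-- A matrix vanishing on the range of `1 - R` is small there on the range of `1 - P`, if `P` and
`R` are close. -/
theorem frobSq_compression_le {P R H : Matrix (Fin n) (Fin n) ℝ} {ε : ℝ}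
    (hPs : Pᵀ = P) (hPi : P * P = P) (hRs : Rᵀ = R) (hRi : R * R = R)
    (hε : ‖R * (1 - P)‖ ^ 2 ≤ ε) (hH : (1 - R) * H * (1 - R) = 0) :
    frobSq ((1 - P) * H * (1 - P)) ≤ 4 * ε * frobSq H := by
  have hdec : (1 - P) * H * (1 - P) =
      ((1 - P) * R) * (H * (1 - P)) + ((1 - P) * ((1 - R) * H)) * (R * (1 - P)) := by
    -- The missing corner (1 - R)H(1 - R) is zero, so each remaining term has a factor R that meets
    -- 1 - P on one side.
    have h1 : H = R * H + (1 - R) * H * R := by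
      have : (1 - R) * H * R = (1 - R) * H - (1 - R) * H * (1 - R) := by noncomm_ring
      rw [this, hH]; noncomm_ring
    calc (1 - P) * H * (1 - P) = (1 - P) * (R * H + (1 - R) * H * R) * (1 - P) := by rw [← h1]
      _ = _ := by noncomm_ring
  have hP1 := projection_opNorm_sq_le (one_sub_projection_transpose hPs)
    (one_sub_projection_mul_self hPi)
  have hR1 := projection_opNorm_sq_le (one_sub_projection_transpose hRs)
    (one_sub_projection_mul_self hRi)
  have hε' : ‖(1 - P) * R‖ ^ 2 ≤ ε := by
    rw [← opNorm_transpose, Matrix.transpose_mul, hRs, one_sub_projection_transpose hPs]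
    exact hε
  have hε0 : 0 ≤ ε := le_trans (by positivity) hε
  have hH0 := frobSq_nonneg H
  have a1 : frobSq (H * (1 - P)) ≤ frobSq H :=
    (frobSq_mul_le' _ _).trans (mul_le_of_le_one_left hH0 hP1)
  have a2 : frobSq ((1 - P) * ((1 - R) * H)) ≤ frobSq H :=
    ((frobSq_mul_le _ _).trans (mul_le_of_le_one_left (frobSq_nonneg _) hP1)).trans
      ((frobSq_mul_le _ _).trans (mul_le_of_le_one_left hH0 hR1))
  have b1 : frobSq (((1 - P) * R) * (H * (1 - P))) ≤ ε * frobSq H :=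
    (frobSq_mul_le _ _).trans (mul_le_mul hε' a1 (frobSq_nonneg _) hε0)
  have b2 : frobSq (((1 - P) * ((1 - R) * H)) * (R * (1 - P))) ≤ ε * frobSq H :=
    (frobSq_mul_le' _ _).trans (mul_le_mul hε a2 (frobSq_nonneg _) hε0)
  rw [hdec]
  refine (frobSq_add_le _ _).trans ?_
  linarith

/-- The orthogonal projection onto the range of `U Uᵀ`. -/
theorem exists_range_projection {k : ℕ} {M : Matrix (Fin n) (Fin n) ℝ}
    {U : Matrix (Fin n) (Fin k) ℝ} (hM : M.IsHermitian) (hU : M = U * Uᵀ) :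
    ∃ (P : Matrix (Fin n) (Fin n) ℝ) (B : Matrix (Fin k) (Fin n) ℝ),
      Pᵀ = P ∧ P * P = P ∧ M * (1 - P) = 0 ∧ P = U * B := by
  obtain ⟨O, d, hO, hMO⟩ : ∃ (O : Matrix (Fin n) (Fin n) ℝ) (d : Fin n → ℝ),
      Oᵀ * O = 1 ∧ M = O * Matrix.diagonal d * Oᵀ := by
    refine ⟨hM.eigenvectorUnitary, hM.eigenvalues, ?_, ?_⟩
    · have := Unitary.coe_star_mul_self hM.eigenvectorUnitary
      rwa [Matrix.star_eq_conjTranspose, Matrix.conjTranspose_eq_transpose_of_trivial] at this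
    · conv_lhs => rw [hM.spectral_theorem]
      rw [Unitary.conjStarAlgAut_apply, Matrix.star_eq_conjTranspose,
        Matrix.conjTranspose_eq_transpose_of_trivial]
      rfl
  have hmul : ∀ a b : Fin n → ℝ, (O * Matrix.diagonal a * Oᵀ) * (O * Matrix.diagonal b * Oᵀ) =
      O * Matrix.diagonal (fun i => a i * b i) * Oᵀ := fun a b => by
    rw [← Matrix.diagonal_mul_diagonal]
    calc _ = O * Matrix.diagonal a * (Oᵀ * O) * Matrix.diagonal b * Oᵀ := by
          simp only [Matrix.mul_assoc]
      _ = _ := by rw [hO]; simp only [Matrix.mul_assoc, Matrix.mul_one]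
  have hP : M * (O * Matrix.diagonal (fun i => (d i)⁻¹) * Oᵀ) =
      O * Matrix.diagonal (fun i => d i * (d i)⁻¹) * Oᵀ := by rw [hMO, hmul]
  -- P = M M⁺ with M⁺ the pseudoinverse: the convention 0⁻¹ = 0 makes d d⁻¹ the indicator of the
  -- nonzero eigenvalues. The factor B = UᵀM⁺ gives P = U B.
  refine ⟨O * Matrix.diagonal (fun i => d i * (d i)⁻¹) * Oᵀ,
    Uᵀ * (O * Matrix.diagonal (fun i => (d i)⁻¹) * Oᵀ), ?_, ?_, ?_, ?_⟩
  · simp [Matrix.transpose_mul, Matrix.mul_assoc]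
  · rw [hmul]
    congr 3; ext i
    by_cases h : d i = 0 <;> simp [h]
  · rw [Matrix.mul_sub, Matrix.mul_one, hMO, hmul, sub_eq_zero]
    congr 3; ext i
    by_cases h : d i = 0 <;> simp [h]
  · rw [← hP, ← Matrix.mul_assoc U, ← hU]

end OrthogonalProjection

/-! ### Coercivity near the tangent space -/

section TangentSpace

/-- Coercivity of the compressed operator on the sum of a matrix in an approximate tangent space
and an arbitrary symmetric matrix. -/
theorem coercive_of_near_tangent {n m k : ℕ} {χ ε : ℝ} {A : Matrix (Fin m) (SymIdx n) ℝ}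
    {Xs : Matrix (Fin n) (Fin n) ℝ} {Us : Matrix (Fin n) (Fin k) ℝ}
    (hinj : TangentInjectivity χ A Xs Us) {P : Matrix (Fin n) (Fin n) ℝ}
    {B : Matrix (Fin k) (Fin n) ℝ} (hPs : Pᵀ = P) (hPi : P * P = P) (hPU : P = Us * B)
    {R : Matrix (Fin n) (Fin n) ℝ} (hRs : Rᵀ = R) (hRi : R * R = R)
    (hε : ‖R * (1 - P)‖ ^ 2 ≤ ε) (hεχ : 64 * χ ^ 2 * ε ≤ 1)
    (hA : ∀ x, (((CFC.sqrt (A * Aᵀ))⁻¹ * A) *ᵥ x) ⬝ᵥ (((CFC.sqrt (A * Aᵀ))⁻¹ * A) *ᵥ x) ≤ x ⬝ᵥ x)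
    {H₁ H₂ : Matrix (Fin n) (Fin n) ℝ} (hH₁ : H₁ᵀ = H₁) (hH₂ : H₂ᵀ = H₂)
    (hH : (1 - R) * H₁ * (1 - R) = 0) :
    frobSq H₁ ≤ 12 * χ ^ 2 *
      ((((CFC.sqrt (A * Aᵀ))⁻¹ * A) *ᵥ svec (H₁ + H₂)) ⬝ᵥ
        (((CFC.sqrt (A * Aᵀ))⁻¹ * A) *ᵥ svec (H₁ + H₂)) + frobSq H₂) := by
  have hχ := hinj.one_le
  set C := (CFC.sqrt (A * Aᵀ))⁻¹ * A with hC
  set Y := (1 - P) * H₁ * (1 - P) with hY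
  have hYs : Yᵀ = Y := by
    rw [hY, Matrix.transpose_mul, Matrix.transpose_mul, hH₁, one_sub_projection_transpose hPs,
      Matrix.mul_assoc]
  have hYle : frobSq Y ≤ 4 * ε * frobSq H₁ := frobSq_compression_le hPs hPi hRs hRi hε hH
  have hZ : ∃ N : Matrix (Fin n) (Fin k) ℝ, H₁ - Y = Us * Nᵀ + N * Usᵀ := by
    -- H₁ - Y = PH₁ + H₁P - PH₁P is tangent: half of the last term goes to each of the others, and P
    -- = Us B pulls out the factor Us.
    refine ⟨(B * H₁ * (1 - (1 / 2 : ℝ) • P))ᵀ, ?_⟩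
    have h1 : Us * (B * H₁ * (1 - (1 / 2 : ℝ) • P)) = P * H₁ - (1 / 2 : ℝ) • (P * H₁ * P) := by
      rw [← Matrix.mul_assoc, ← Matrix.mul_assoc, ← hPU, Matrix.mul_sub, Matrix.mul_one,
        Matrix.mul_smul]
    have h2 : (B * H₁ * (1 - (1 / 2 : ℝ) • P))ᵀ * Usᵀ =
        H₁ * P - (1 / 2 : ℝ) • (P * H₁ * P) := by
      rw [← Matrix.transpose_mul, h1, Matrix.transpose_sub, Matrix.transpose_smul,
        Matrix.transpose_mul, Matrix.transpose_mul, Matrix.transpose_mul, hPs, hH₁,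
        Matrix.mul_assoc]
    have h3 : (1 / 2 : ℝ) • (P * H₁ * P) + (1 / 2 : ℝ) • (P * H₁ * P) = P * H₁ * P := by
      rw [← add_smul]; norm_num
    rw [Matrix.transpose_transpose, h1, h2]
    have h4 : H₁ - Y = P * H₁ + H₁ * P - P * H₁ * P := by rw [hY]; noncomm_ring
    rw [h4]
    conv_lhs => rw [← h3]
    abel
  obtain ⟨N, hN⟩ := hZ
  have hb := hinj.bound N
  rw [← hN, ← hC] at hb
  have hχ0 : 0 < χ := by linarith
  have hZle : frobSq (H₁ - Y) ≤ χ ^ 2 * ((C *ᵥ svec (H₁ - Y)) ⬝ᵥ (C *ᵥ svec (H₁ - Y))) := by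
    rw [← euclNorm_sq, ← frobNorm_sq, ← mul_pow]
    refine pow_le_pow_left₀ (Real.sqrt_nonneg _) ?_ 2
    rwa [inv_mul_le_iff₀ hχ0] at hb
  have hsplit : C *ᵥ svec (H₁ - Y) = (C *ᵥ svec (H₁ + H₂) - C *ᵥ svec H₂) - C *ᵥ svec Y := by
    have e1 : svec (H₁ + H₂) = svec (H₁ - Y) + svec Y + svec H₂ := by
      rw [← svec_add, ← svec_add, sub_add_cancel]
    rw [e1, Matrix.mulVec_add, Matrix.mulVec_add]; abel
  set q := (C *ᵥ svec (H₁ + H₂)) ⬝ᵥ (C *ᵥ svec (H₁ + H₂)) with hq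
  have hCY : (C *ᵥ svec Y) ⬝ᵥ (C *ᵥ svec Y) ≤ frobSq Y :=
    (hA _).trans (svec_dotProduct_self hYs).le
  have hCH : (C *ᵥ svec H₂) ⬝ᵥ (C *ᵥ svec H₂) ≤ frobSq H₂ :=
    (hA _).trans (svec_dotProduct_self hH₂).le
  have hn1 : (C *ᵥ svec (H₁ - Y)) ⬝ᵥ (C *ᵥ svec (H₁ - Y)) ≤ 3 * (q + frobSq H₂ + frobSq Y) := by
    have hsq : ∀ a b c : Fin m → ℝ, (a - b - c) ⬝ᵥ (a - b - c) ≤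
        3 * (a ⬝ᵥ a + b ⬝ᵥ b + c ⬝ᵥ c) := fun a b c => by
      have e1 := dotProduct_self_nonneg_real (a + b)
      have e2 := dotProduct_self_nonneg_real (a + c)
      have e3 := dotProduct_self_nonneg_real (b - c)
      simp only [add_dotProduct, dotProduct_add, sub_dotProduct, dotProduct_sub] at *
      linarith [dotProduct_comm a b, dotProduct_comm a c, dotProduct_comm b c]
    rw [hsplit]
    refine (hsq _ _ _).trans ?_
    linarith
  have hH1 : frobSq H₁ ≤ 2 * frobSq (H₁ - Y) + 2 * frobSq Y := by
    simpa using frobSq_add_le (H₁ - Y) Y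
  have hχ2 : 1 ≤ χ ^ 2 := one_le_pow₀ hχ
  have h3 : χ ^ 2 * ((C *ᵥ svec (H₁ - Y)) ⬝ᵥ (C *ᵥ svec (H₁ - Y))) ≤
      χ ^ 2 * (3 * (q + frobSq H₂ + frobSq Y)) := mul_le_mul_of_nonneg_left hn1 (by positivity)
  -- The choice 64χ²ε ≤ 1 makes the total contribution 6χ²|Y|² + 2|Y|² of the error at most |H₁|²/2,
  -- which is absorbed on the left; this doubles 6χ² to 12χ².
  have h4 : χ ^ 2 * frobSq Y ≤ frobSq H₁ / 16 := by
    have : χ ^ 2 * frobSq Y ≤ χ ^ 2 * (4 * ε * frobSq H₁) :=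
      mul_le_mul_of_nonneg_left hYle (by positivity)
    nlinarith [mul_le_mul_of_nonneg_right hεχ (frobSq_nonneg H₁)]
  have h5 : frobSq Y ≤ χ ^ 2 * frobSq Y := le_mul_of_one_le_left (frobSq_nonneg _) hχ2
  nlinarith

end TangentSpace

/-! ### Comparison of the scaling point W with X and S -/

section Scaling

variable {n : ℕ} {μ L δ χ₁ : ℝ} {X S Xs Ss : Matrix (Fin n) (Fin n) ℝ}

theorem sqrt_transpose {ι : Type*} [Fintype ι] [DecidableEq ι] (M : Matrix ι ι ℝ) :
    (CFC.sqrt M)ᵀ = CFC.sqrt M :=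
  transpose_eq_of_isHermitian (Matrix.nonneg_iff_posSemidef.1 (CFC.sqrt_nonneg M)).1

theorem quadForm_eq_sqrt {ι : Type*} [Fintype ι] [DecidableEq ι] {M : Matrix ι ι ℝ}
    (hM : M.PosSemidef) (v : ι → ℝ) :
    v ⬝ᵥ M *ᵥ v = (CFC.sqrt M *ᵥ v) ⬝ᵥ (CFC.sqrt M *ᵥ v) := by
  rw [mulVec_dotProduct_eq, sqrt_transpose, Matrix.mulVec_mulVec,
    CFC.sqrt_mul_sqrt_self M (Matrix.nonneg_iff_posSemidef.2 hM)]

theorem isUnit_of_quadForm_le {ι : Type*} [Fintype ι] [DecidableEq ι] {M : Matrix ι ι ℝ} {c : ℝ}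
    (hc : 0 < c) (h : ∀ v, c * (v ⬝ᵥ v) ≤ (M *ᵥ v) ⬝ᵥ (M *ᵥ v)) : IsUnit M := by
  rw [← Matrix.mulVec_injective_iff_isUnit]
  intro u v huv
  have h1 := h (u - v)
  rw [Matrix.mulVec_sub, sub_eq_zero.2 huv, dotProduct_zero] at h1
  have h2 := dotProduct_self_nonneg_real (u - v)
  have h3 : (u - v) ⬝ᵥ (u - v) = 0 := by nlinarith
  exact sub_eq_zero.1 (dotProduct_self_eq_zero.1 h3)

namespace Centrality

theorem quadForm_centered (h : Centrality μ L δ χ₁ X S Xs Ss) (hμ : 0 < μ) (v : Fin n → ℝ) :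
    (1 - δ) * μ * (v ⬝ᵥ v) ≤ v ⬝ᵥ (CFC.sqrt X * S * CFC.sqrt X) *ᵥ v := by
  have h1 := (abs_le.1 ((abs_quadForm_le _ v).trans (mul_le_mul_of_nonneg_right h.centered
    (dotProduct_self_nonneg_real v)))).1
  rw [Matrix.sub_mulVec, dotProduct_sub, Matrix.smul_mulVec, dotProduct_smul,
    Matrix.one_mulVec, smul_eq_mul] at h1
  have h2 : (1 - δ) * (v ⬝ᵥ v) ≤ μ⁻¹ * (v ⬝ᵥ (CFC.sqrt X * S * CFC.sqrt X) *ᵥ v) := by linarith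
  rw [inv_mul_eq_div, le_div_iff₀ hμ] at h2
  linarith

theorem posSemidef_centered (h : Centrality μ L δ χ₁ X S Xs Ss) :
    (CFC.sqrt X * S * CFC.sqrt X).PosSemidef := by
  have := h.S_posDef.posSemidef.conjTranspose_mul_mul_same (CFC.sqrt X)
  rwa [Matrix.conjTranspose_eq_transpose_of_trivial, sqrt_transpose] at this

theorem sqrt_centered_le (h : Centrality μ L δ χ₁ X S Xs Ss) (hμ : 0 < μ) (v : Fin n → ℝ) :
    (1 - δ) * μ * (v ⬝ᵥ v) ≤ (CFC.sqrt (CFC.sqrt X * S * CFC.sqrt X) *ᵥ v) ⬝ᵥ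
      (CFC.sqrt (CFC.sqrt X * S * CFC.sqrt X) *ᵥ v) := by
  rw [← quadForm_eq_sqrt h.posSemidef_centered]
  exact h.quadForm_centered hμ v

theorem isUnit_sqrt_centered (h : Centrality μ L δ χ₁ X S Xs Ss) (hμ : 0 < μ) :
    IsUnit (CFC.sqrt (CFC.sqrt X * S * CFC.sqrt X)) :=
  isUnit_of_quadForm_le (mul_pos (sub_pos.2 h.δ_lt_one) hμ) (h.sqrt_centered_le hμ)

/-- W = X^{1/2} R⁻¹ X^{1/2} with R² ⪰ (1-δ)μ I, so R⁻¹ has norm at most ((1-δ)μ)^{-1/2}. The weaker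
factor 1-δ ≤ (1-δ)^{1/2} avoids a square root. -/
theorem quadForm_ntScaling_le (h : Centrality μ L δ χ₁ X S Xs Ss) (hμ : 0 < μ)
    (v : Fin n → ℝ) : (1 - δ) * √μ * (v ⬝ᵥ ntScaling X S *ᵥ v) ≤ v ⬝ᵥ X *ᵥ v := by
  have hδ := h.δ_lt_one
  have hδ0 := h.δ_nonneg
  set R := CFC.sqrt (CFC.sqrt X * S * CFC.sqrt X) with hR
  set y := CFC.sqrt X *ᵥ v with hy
  set u := R⁻¹ *ᵥ y with hu
  have hRu : R *ᵥ u = y := by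
    rw [hu, Matrix.mulVec_mulVec, Matrix.mul_nonsing_inv _
      ((Matrix.isUnit_iff_isUnit_det _).1 (h.isUnit_sqrt_centered hμ)), Matrix.one_mulVec]
  have h1 : v ⬝ᵥ ntScaling X S *ᵥ v = y ⬝ᵥ u := by
    rw [hy, mulVec_dotProduct_eq, sqrt_transpose, hu, Matrix.mulVec_mulVec, hy,
      Matrix.mulVec_mulVec]
    rfl
  have h2 : v ⬝ᵥ X *ᵥ v = euclNorm y ^ 2 := by
    rw [quadForm_eq_sqrt h.X_posDef.posSemidef, euclNorm_sq]
  have h3 := h.sqrt_centered_le hμ u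
  rw [← hR, hRu, ← euclNorm_sq, ← euclNorm_sq] at h3
  have hsq := Real.sq_sqrt hμ.le
  have hs0 := Real.sqrt_nonneg μ
  have hy0 := euclNorm_nonneg y
  have hu0 := euclNorm_nonneg u
  have h4 : (1 - δ) * √μ * euclNorm u ≤ euclNorm y := by
    refine le_of_sq_le_sq ?_ hy0
    refine le_trans ?_ h3
    rw [mul_pow, mul_pow, hsq]
    have : (1 - δ) ^ 2 ≤ 1 - δ := by nlinarith
    exact mul_le_mul_of_nonneg_right (mul_le_mul_of_nonneg_right this hμ.le) (sq_nonneg _)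
  have h5 := (le_abs_self _).trans (abs_dotProduct_le y u)
  rw [h1, h2]
  calc (1 - δ) * √μ * (y ⬝ᵥ u) ≤ (1 - δ) * √μ * (euclNorm y * euclNorm u) :=
        mul_le_mul_of_nonneg_left h5 (mul_nonneg (by linarith) hs0)
    _ ≤ euclNorm y ^ 2 := by nlinarith

theorem quadForm_ntScaling_nonneg (h : Centrality μ L δ χ₁ X S Xs Ss) (hμ : 0 < μ)
    (v : Fin n → ℝ) : 0 ≤ v ⬝ᵥ ntScaling X S *ᵥ v := by
  set R := CFC.sqrt (CFC.sqrt X * S * CFC.sqrt X) with hR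
  set u := R⁻¹ *ᵥ (CFC.sqrt X *ᵥ v) with hu
  have hRu : R *ᵥ u = CFC.sqrt X *ᵥ v := by
    rw [hu, Matrix.mulVec_mulVec, Matrix.mul_nonsing_inv _
      ((Matrix.isUnit_iff_isUnit_det _).1 (h.isUnit_sqrt_centered hμ)), Matrix.one_mulVec]
  have h1 : v ⬝ᵥ ntScaling X S *ᵥ v = u ⬝ᵥ R *ᵥ u := by
    rw [hRu, dotProduct_comm u, mulVec_dotProduct_eq, sqrt_transpose, hu,
      Matrix.mulVec_mulVec, Matrix.mulVec_mulVec]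
    rfl
  rw [h1]
  exact quadForm_nonneg (Matrix.nonneg_iff_posSemidef.1 (CFC.sqrt_nonneg _)) u

/-- The defining identity of the scaling point; on an eigenvector of W it relates the squared
eigenvalue to the forms of X and S. -/
theorem ntScaling_mul_mul (h : Centrality μ L δ χ₁ X S Xs Ss) (hμ : 0 < μ) :
    ntScaling X S * S * ntScaling X S = X := by
  have hM := CFC.sqrt_mul_sqrt_self _ (Matrix.nonneg_iff_posSemidef.2 h.posSemidef_centered)
  have hX := CFC.sqrt_mul_sqrt_self X (Matrix.nonneg_iff_posSemidef.2 h.X_posDef.posSemidef)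
  have hdet := (Matrix.isUnit_iff_isUnit_det _).1 (h.isUnit_sqrt_centered hμ)
  unfold ntScaling
  set R := CFC.sqrt (CFC.sqrt X * S * CFC.sqrt X) with hR
  calc CFC.sqrt X * R⁻¹ * CFC.sqrt X * S * (CFC.sqrt X * R⁻¹ * CFC.sqrt X)
      = CFC.sqrt X * R⁻¹ * (CFC.sqrt X * S * CFC.sqrt X) * R⁻¹ * CFC.sqrt X := by
        simp only [Matrix.mul_assoc]
    _ = CFC.sqrt X * (R⁻¹ * R) * (R * R⁻¹) * CFC.sqrt X := by
        rw [← hM]; simp only [Matrix.mul_assoc]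
    _ = X := by
        rw [Matrix.nonsing_inv_mul _ hdet, Matrix.mul_nonsing_inv _ hdet, Matrix.mul_one,
          Matrix.mul_one, hX]

/-- S is within L of S*, and S* ⪯ X* + S* ⪯ I. -/
theorem quadForm_S_le (h : Centrality μ L δ χ₁ X S Xs Ss) (v : Fin n → ℝ) :
    v ⬝ᵥ S *ᵥ v ≤ 2 * max 1 L * (v ⬝ᵥ v) := by
  have hv := dotProduct_self_nonneg_real v
  have h1 := (abs_le.1 ((abs_quadForm_le _ v).trans (mul_le_mul_of_nonneg_right h.S_close hv))).2
  have h2 := quadForm_nonneg h.upper v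
  have h3 := quadForm_nonneg h.Xs_posSemidef v
  simp only [Matrix.sub_mulVec, dotProduct_sub, Matrix.add_mulVec, dotProduct_add,
    Matrix.one_mulVec] at h1 h2
  nlinarith [mul_le_mul_of_nonneg_right (le_max_left 1 L) hv,
    mul_le_mul_of_nonneg_right (le_max_right 1 L) hv]

/-- Centrality bounds X^{1/2} S X^{1/2} below by (1-δ)μ, and S is bounded above, so X cannot be
small. -/
theorem quadForm_X_ge (h : Centrality μ L δ χ₁ X S Xs Ss) (hμ : 0 < μ) (v : Fin n → ℝ) :
    (1 - δ) * μ * (v ⬝ᵥ v) ≤ 2 * max 1 L * (v ⬝ᵥ X *ᵥ v) := by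
  refine (h.quadForm_centered hμ v).trans ?_
  have h1 : v ⬝ᵥ (CFC.sqrt X * S * CFC.sqrt X) *ᵥ v =
      (CFC.sqrt X *ᵥ v) ⬝ᵥ S *ᵥ (CFC.sqrt X *ᵥ v) := by
    rw [mulVec_dotProduct_eq, sqrt_transpose, Matrix.mulVec_mulVec,
      Matrix.mulVec_mulVec, Matrix.mul_assoc]
  rw [h1, quadForm_eq_sqrt h.X_posDef.posSemidef v]
  exact h.quadForm_S_le _

theorem quadForm_X_le_of_mulVec_eq_zero (h : Centrality μ L δ χ₁ X S Xs Ss) {v : Fin n → ℝ}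
    (hv : Xs *ᵥ v = 0) : v ⬝ᵥ X *ᵥ v ≤ L * μ * (v ⬝ᵥ v) := by
  have h1 := (abs_le.1 ((abs_quadForm_le _ v).trans
    (mul_le_mul_of_nonneg_right h.X_close (dotProduct_self_nonneg_real v)))).2
  rwa [Matrix.sub_mulVec, hv, sub_zero] at h1

theorem one_le_χ₁ (h : Centrality μ L δ χ₁ X S Xs Ss) (hn : 0 < n) : 1 ≤ χ₁ := by
  have h1 := quadForm_nonneg h.strict_lower (Pi.single ⟨0, hn⟩ 1)
  have h2 := quadForm_nonneg h.upper (Pi.single ⟨0, hn⟩ 1)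
  simp only [Matrix.sub_mulVec, dotProduct_sub, Matrix.smul_mulVec, dotProduct_smul,
    Matrix.one_mulVec, smul_eq_mul, single_dotProduct, Pi.single_eq_same, one_mul, mul_one]
    at h1 h2
  have h3 : χ₁⁻¹ ≤ 1 := by linarith
  exact (inv_le_one₀ h.χ₁_pos).1 h3

end Centrality

end Scaling

/-! ### Spectral projections of W -/

section Eigendecomposition

namespace IsOrderedEigendecomposition

variable {n : ℕ} {W V : Matrix (Fin n) (Fin n) ℝ} {w : Fin n → ℝ}

theorem mul_transpose (h : IsOrderedEigendecomposition W V w) : V * Vᵀ = 1 :=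
  mul_eq_one_comm.1 h.orthonormal

theorem dotProduct_mulVec_mulVec (h : IsOrderedEigendecomposition W V w) (c : Fin n → ℝ) :
    (V *ᵥ c) ⬝ᵥ (V *ᵥ c) = c ⬝ᵥ c := by
  rw [mulVec_dotProduct_eq, Matrix.mulVec_mulVec, h.orthonormal, Matrix.one_mulVec]

theorem mulVec_mulVec_eq (h : IsOrderedEigendecomposition W V w) (c : Fin n → ℝ) :
    W *ᵥ (V *ᵥ c) = V *ᵥ (fun i => w i * c i) := by
  have : W * V = V * Matrix.diagonal w := by
    rw [h.eq, Matrix.mul_assoc, h.orthonormal, Matrix.mul_one]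
  rw [Matrix.mulVec_mulVec, this, ← Matrix.mulVec_mulVec]
  congr 1; ext i; rw [Matrix.mulVec_diagonal]

theorem quadForm_mulVec (h : IsOrderedEigendecomposition W V w) (c : Fin n → ℝ) :
    (V *ᵥ c) ⬝ᵥ W *ᵥ (V *ᵥ c) = ∑ i, w i * c i ^ 2 := by
  rw [h.mulVec_mulVec_eq, mulVec_dotProduct_eq, Matrix.mulVec_mulVec, h.orthonormal,
    Matrix.one_mulVec]
  exact Finset.sum_congr rfl fun i _ => by ring

theorem transpose_eq (h : IsOrderedEigendecomposition W V w) : Wᵀ = W := by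
  rw [h.eq]; simp [Matrix.transpose_mul, Matrix.mul_assoc]

/-- The spectral projection of `W` onto eigenvalues larger than `T`. -/
noncomputable def spectralProj (V : Matrix (Fin n) (Fin n) ℝ) (w : Fin n → ℝ) (T : ℝ) :
    Matrix (Fin n) (Fin n) ℝ :=
  V * Matrix.diagonal (fun i => if T < w i then 1 else 0) * Vᵀ

theorem spectralProj_transpose (T : ℝ) : (spectralProj V w T)ᵀ = spectralProj V w T := by
  simp [spectralProj, Matrix.transpose_mul, Matrix.mul_assoc]

theorem spectralProj_mul_self (h : IsOrderedEigendecomposition W V w) (T : ℝ) :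
    spectralProj V w T * spectralProj V w T = spectralProj V w T := by
  set D : Matrix (Fin n) (Fin n) ℝ := Matrix.diagonal (fun i => if T < w i then 1 else 0) with hD
  have hDD : D * D = D := by
    rw [hD, Matrix.diagonal_mul_diagonal]; congr 1; ext i; split_ifs <;> simp
  calc V * D * Vᵀ * (V * D * Vᵀ) = V * D * (Vᵀ * V) * D * Vᵀ := by simp only [Matrix.mul_assoc]
    _ = V * (D * D) * Vᵀ := by rw [h.orthonormal]; simp only [Matrix.mul_assoc, Matrix.one_mul]
    _ = V * D * Vᵀ := by rw [hDD]

theorem one_sub_spectralProj (h : IsOrderedEigendecomposition W V w) (T : ℝ) :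
    1 - spectralProj V w T = V * Matrix.diagonal (fun i => if T < w i then 0 else 1) * Vᵀ := by
  have : Matrix.diagonal (fun i => if T < w i then (0 : ℝ) else 1) =
      1 - Matrix.diagonal (fun i => if T < w i then 1 else 0) := by
    rw [← Matrix.diagonal_one, Matrix.diagonal_sub]; congr 1; ext i; split_ifs <;> simp
  rw [this, Matrix.mul_sub, Matrix.sub_mul, Matrix.mul_one, h.mul_transpose, spectralProj]

/-- Chebyshev's inequality in eigencoordinates: T times the indicator of w > T is at most w. -/
theorem mul_spectralProj_le (h : IsOrderedEigendecomposition W V w) (hw : ∀ i, 0 ≤ w i)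
    {T : ℝ} (v : Fin n → ℝ) :
    T * ((spectralProj V w T *ᵥ v) ⬝ᵥ (spectralProj V w T *ᵥ v)) ≤ v ⬝ᵥ W *ᵥ v := by
  have hv : v = V *ᵥ (Vᵀ *ᵥ v) := by rw [Matrix.mulVec_mulVec, h.mul_transpose, Matrix.one_mulVec]
  have h1 : spectralProj V w T *ᵥ v =
      V *ᵥ (fun i => (if T < w i then 1 else 0) * (Vᵀ *ᵥ v) i) := by
    rw [spectralProj, ← Matrix.mulVec_mulVec, ← Matrix.mulVec_mulVec]
    congr 1; ext i; rw [Matrix.mulVec_diagonal]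
  conv_rhs => rw [hv]
  rw [h1, h.dotProduct_mulVec_mulVec, h.quadForm_mulVec, dotProduct, Finset.mul_sum]
  refine Finset.sum_le_sum fun i _ => ?_
  split_ifs with hT
  · nlinarith [mul_le_mul_of_nonneg_right hT.le (sq_nonneg ((Vᵀ *ᵥ v) i))]
  · simpa using mul_nonneg (hw i) (sq_nonneg ((Vᵀ *ᵥ v) i))

end IsOrderedEigendecomposition

end Eigendecomposition

/-! ### Eigenvalues of W on the scale √μ -/

section ScalingSpectrum

variable {n : ℕ} {μ L δ χ₁ : ℝ} {X S Xs Ss W V : Matrix (Fin n) (Fin n) ℝ} {w : Fin n → ℝ}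

namespace Centrality

theorem eigenvalue_nonneg (h : Centrality μ L δ χ₁ X S Xs Ss) (hμ : 0 < μ)
    (hE : IsOrderedEigendecomposition (ntScaling X S) V w) (i : Fin n) : 0 ≤ w i := by
  have h1 := h.quadForm_ntScaling_nonneg hμ (V *ᵥ Pi.single i 1)
  rw [hE.quadForm_mulVec] at h1
  simpa [Pi.single_apply] using h1

/-- For a unit eigenvector v, WSW = X gives vᵀXv = w² vᵀSv. Here vᵀXv is at least (1-δ)μ / (2 max(1,
L)) and vᵀSv is at most 2 max(1, L). -/
theorem eigenvalue_ge (h : Centrality μ L δ χ₁ X S Xs Ss) (hμ : 0 < μ)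
    (hE : IsOrderedEigendecomposition (ntScaling X S) V w) (i : Fin n) :
    (1 - δ) * √μ ≤ 2 * max 1 L * w i := by
  have hw := h.eigenvalue_nonneg hμ hE i
  have hδ := h.δ_lt_one
  have hδ0 := h.δ_nonneg
  have hL : 1 ≤ max 1 L := le_max_left _ _
  set v := V *ᵥ Pi.single i (1 : ℝ) with hv
  have hvv : v ⬝ᵥ v = 1 := by rw [hE.dotProduct_mulVec_mulVec]; simp
  have hWv : ntScaling X S *ᵥ v = w i • v := by
    rw [hv, hE.mulVec_mulVec_eq, ← Matrix.mulVec_smul]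
    congr 1; ext j; by_cases hj : j = i
    · subst hj; simp
    · simp [hj]
  have h1 : v ⬝ᵥ X *ᵥ v = w i ^ 2 * (v ⬝ᵥ S *ᵥ v) := by
    conv_lhs => rw [← h.ntScaling_mul_mul hμ]
    rw [← Matrix.mulVec_mulVec, hWv, ← Matrix.mulVec_mulVec, ← hE.transpose_eq,
      ← mulVec_dotProduct_eq, hWv, Matrix.mulVec_smul, dotProduct_smul, smul_dotProduct,
      smul_eq_mul, smul_eq_mul]
    ring
  have h2 := h.quadForm_X_ge hμ v
  have h3 := h.quadForm_S_le v
  rw [h1, hvv, mul_one] at h2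
  rw [hvv, mul_one] at h3
  refine le_of_sq_le_sq ?_ (by positivity)
  rw [mul_pow, Real.sq_sqrt hμ.le]
  have h4 : (1 - δ) ^ 2 * μ ≤ (1 - δ) * μ :=
    mul_le_mul_of_nonneg_right (by nlinarith) hμ.le
  have h5 : 2 * max 1 L * (w i ^ 2 * (v ⬝ᵥ S *ᵥ v)) ≤ 2 * max 1 L * (w i ^ 2 * (2 * max 1 L)) :=
    mul_le_mul_of_nonneg_left (mul_le_mul_of_nonneg_left h3 (sq_nonneg _)) (by positivity)
  nlinarith

/-- Courant-Fischer argument: the top r+1 eigenvectors span a space meeting the kernel of X*. There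
W is at least its (r+1)-st eigenvalue, whereas X is at most Lμ. -/
theorem eigenvalue_le_of_rank_le (h : Centrality μ L δ χ₁ X S Xs Ss) (hμ : 0 < μ)
    (hE : IsOrderedEigendecomposition (ntScaling X S) V w) {r : ℕ} (hr : r < n)
    (hrank : Xs.rank ≤ r) : (1 - δ) * w ⟨r, hr⟩ ≤ L * √μ := by
  set E : Matrix (Fin n) (Fin (r + 1)) ℝ :=
    (1 : Matrix (Fin n) (Fin n) ℝ).submatrix id (Fin.castLE hr) with hEdef
  -- X* has rank at most r, so it is not injective on a space of dimension r+1.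
  obtain ⟨c, hc0, hc⟩ : ∃ c, c ≠ 0 ∧ (Xs * (V * E)) *ᵥ c = 0 := by
    by_contra hcon
    push Not at hcon
    have hinj : Function.Injective (Xs * (V * E)).mulVecLin := by
      rw [injective_iff_map_eq_zero]
      intro c hc
      by_contra hne
      exact hcon c hne (by simpa using hc)
    have h1 := LinearMap.finrank_range_of_inj hinj
    have h2 : (Xs * (V * E)).rank ≤ r := (Matrix.rank_mul_le_left _ _).trans hrank
    rw [Matrix.rank, h1] at h2
    simp at h2
  set b := E *ᵥ c with hb
  have hbc : b ⬝ᵥ b = c ⬝ᵥ c := by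
    rw [hb, mulVec_dotProduct_eq, Matrix.mulVec_mulVec]
    have : Eᵀ * E = 1 := by
      ext i j
      simp only [hEdef, Matrix.mul_apply, Matrix.transpose_apply, Matrix.submatrix_apply, id,
        Matrix.one_apply]
      simp [Fin.castLE_inj, eq_comm]
    rw [this, Matrix.one_mulVec]
  have hb0 : 0 < b ⬝ᵥ b := by
    rw [hbc]
    refine lt_of_le_of_ne (dotProduct_self_nonneg_real c) fun h0 => hc0 ?_
    exact dotProduct_self_eq_zero.1 h0.symm
  have hbz : ∀ i : Fin n, r < i → b i = 0 := by
    intro i hi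
    rw [hb, Matrix.mulVec, dotProduct]
    refine Finset.sum_eq_zero fun j _ => ?_
    have : i ≠ Fin.castLE hr j := by
      have := j.2
      simp only [ne_eq, Fin.ext_iff, Fin.val_castLE]; omega
    simp [hEdef, this]
  have hX : Xs *ᵥ (V *ᵥ b) = 0 := by
    rw [hb, Matrix.mulVec_mulVec, Matrix.mulVec_mulVec, Matrix.mul_assoc]; exact hc
  have h1 := h.quadForm_X_le_of_mulVec_eq_zero hX
  have h2 := h.quadForm_ntScaling_le hμ (V *ᵥ b)
  rw [hE.dotProduct_mulVec_mulVec] at h1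
  rw [hE.quadForm_mulVec] at h2
  have h3 : w ⟨r, hr⟩ * (b ⬝ᵥ b) ≤ ∑ i, w i * b i ^ 2 := by
    rw [dotProduct, Finset.mul_sum]
    refine Finset.sum_le_sum fun i _ => ?_
    by_cases hi : r < i
    · simp [hbz i hi]
    · rw [← sq]
      exact mul_le_mul_of_nonneg_right (hE.antitone (by rw [Fin.le_def]; simpa using hi))
        (sq_nonneg _)
  have hs : 0 < √μ := Real.sqrt_pos.2 hμ
  have hd : 0 < 1 - δ := sub_pos.2 h.δ_lt_one
  have h4 : (1 - δ) * √μ * (w ⟨r, hr⟩ * (b ⬝ᵥ b)) ≤ L * μ * (b ⬝ᵥ b) :=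
    (mul_le_mul_of_nonneg_left h3 (by positivity)).trans (h2.trans h1)
  have h5 : ((1 - δ) * w ⟨r, hr⟩) * (√μ * (b ⬝ᵥ b)) ≤ (L * √μ) * (√μ * (b ⬝ᵥ b)) := by
    have : √μ * √μ = μ := Real.mul_self_sqrt hμ.le
    calc _ = (1 - δ) * √μ * (w ⟨r, hr⟩ * (b ⬝ᵥ b)) := by ring
      _ ≤ L * μ * (b ⬝ᵥ b) := h4
      _ = _ := by linear_combination -(L * (b ⬝ᵥ b)) * this
  exact le_of_mul_le_mul_right h5 (by positivity)

open IsOrderedEigendecomposition in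
-- Vectors in the range of 1 - P are killed by X*, hence have W-energy at most L√μ/(1-δ). By
-- Chebyshev, little of their mass sits on eigenvalues above T.
theorem spectralProj_mul_one_sub_le (h : Centrality μ L δ χ₁ X S Xs Ss) (hμ : 0 < μ)
    (hE : IsOrderedEigendecomposition (ntScaling X S) V w) {P : Matrix (Fin n) (Fin n) ℝ}
    (hPs : Pᵀ = P) (hPi : P * P = P) (hXP : Xs * (1 - P) = 0) {T : ℝ} (hT : 0 < T) :
    ‖spectralProj V w T * (1 - P)‖ ^ 2 ≤ L * √μ / ((1 - δ) * T) := by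
  have hs : 0 < √μ := Real.sqrt_pos.2 hμ
  have hd : 0 < 1 - δ := sub_pos.2 h.δ_lt_one
  have hL := h.L_nonneg
  refine opNorm_sq_le_of_dotProduct_le (by positivity) fun v => ?_
  rw [← Matrix.mulVec_mulVec]
  set u := (1 - P) *ᵥ v with hu
  have hXu : Xs *ᵥ u = 0 := by rw [hu, Matrix.mulVec_mulVec, hXP, Matrix.zero_mulVec]
  have h1 := h.quadForm_X_le_of_mulVec_eq_zero hXu
  have h2 := h.quadForm_ntScaling_le hμ u
  have h3 := hE.mul_spectralProj_le (h.eigenvalue_nonneg hμ hE) (T := T) u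
  have h4 : u ⬝ᵥ u ≤ v ⬝ᵥ v := projection_dotProduct_self_le (one_sub_projection_transpose hPs)
    (one_sub_projection_mul_self hPi) v
  set z := (spectralProj V w T *ᵥ u) ⬝ᵥ (spectralProj V w T *ᵥ u) with hz
  have h5 : (1 - δ) * √μ * (T * z) ≤ L * μ * (v ⬝ᵥ v) :=
    (mul_le_mul_of_nonneg_left h3 (by positivity)).trans (h2.trans (h1.trans
      (mul_le_mul_of_nonneg_left h4 (by positivity))))
  rw [div_mul_eq_mul_div, le_div_iff₀ (by positivity)]
  refine le_of_mul_le_mul_right ?_ hs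
  have : √μ * √μ = μ := Real.mul_self_sqrt hμ.le
  calc z * ((1 - δ) * T) * √μ = (1 - δ) * √μ * (T * z) := by ring
    _ ≤ L * μ * (v ⬝ᵥ v) := h5
    _ = _ := by linear_combination -(L * (v ⬝ᵥ v)) * this

end Centrality

end ScalingSpectrum

/-! ### Coercivity from the spectral splitting -/

section Coercivity

open IsOrderedEigendecomposition

theorem smat_apply_eq_zero {n : ℕ} {x : SymIdx n → ℝ} {s : Fin n → Prop}
    (hx : ∀ q : SymIdx n, s q.1.1 → s q.1.2 → x q = 0) {a b : Fin n} (ha : s a) (hb : s b) :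
    smat x a b = 0 := by
  have key : ∀ c d : Fin n, c ≤ d → s c → s d → smat x c d = 0 := fun c d hcd hc hd => by
    have h1 := smat_apply_of_le x ⟨(c, d), hcd⟩
    rw [hx _ hc hd] at h1
    refine (mul_eq_zero.1 h1.symm).resolve_left ?_
    split_ifs <;> positivity
  rcases le_total a b with hab | hab
  · exact key a b hab ha hb
  · rw [← smat_transpose]; exact key b a hab hb ha

theorem lowRankMat_add {n r : ℕ} (hr : r < n) (V : Matrix (Fin n) (Fin n) ℝ)
    (h₁ h₂ : LowRankIdx n r → ℝ) :
    lowRankMat hr V (h₁ + h₂) = lowRankMat hr V h₁ + lowRankMat hr V h₂ := by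
  have : extendPair hr (h₁ + h₂) = extendPair hr h₁ + extendPair hr h₂ := by
    have := Function.extend_add (pairIdx hr) h₁ h₂ 0 0
    rwa [add_zero] at this
  rw [lowRankMat, this, smat_add, Matrix.mul_add, Matrix.add_mul]; rfl

/-- In a pair, the first index carries the larger eigenvalue. If h is supported on pairs where it
exceeds T, the block with both eigenvalues at most T vanishes in eigencoordinates. -/
theorem one_sub_spectralProj_mul_lowRankMat {n r : ℕ} (hr : r < n)
    {W V : Matrix (Fin n) (Fin n) ℝ} {w : Fin n → ℝ} (hE : IsOrderedEigendecomposition W V w)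
    {T : ℝ} {h : LowRankIdx n r → ℝ} (hh : ∀ j, w (pairIdx hr j).1.1 ≤ T → h j = 0) :
    (1 - spectralProj V w T) * lowRankMat hr V h * (1 - spectralProj V w T) = 0 := by
  rw [hE.one_sub_spectralProj, lowRankMat]
  set D : Matrix (Fin n) (Fin n) ℝ := Matrix.diagonal (fun i => if T < w i then 0 else 1) with hD
  have h0 : D * smat (extendPair hr h) * D = 0 := by
    ext a b
    rw [hD, Matrix.mul_diagonal, Matrix.diagonal_mul]
    by_cases ha : T < w a
    · simp [ha]
    by_cases hb : T < w b
    · simp [hb]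
    rw [smat_apply_eq_zero (s := fun i => w i ≤ T) _ (not_lt.1 ha) (not_lt.1 hb)]
    · simp
    · intro q hq _
      by_cases hq' : ∃ j, pairIdx hr j = q
      · obtain ⟨j, rfl⟩ := hq'
        rw [extendPair_apply, hh j hq]
      · rw [extendPair, Function.extend_apply' _ _ _ hq']; rfl
  calc V * D * Vᵀ * (V * smat (extendPair hr h) * Vᵀ) * (V * D * Vᵀ)
      = V * D * (Vᵀ * V) * smat (extendPair hr h) * (Vᵀ * V) * D * Vᵀ := by
        simp only [Matrix.mul_assoc]
    _ = V * (D * smat (extendPair hr h) * D) * Vᵀ := by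
        rw [hE.orthonormal]; simp only [Matrix.mul_assoc, Matrix.one_mul]
    _ = 0 := by rw [h0]; simp

/-- The part of h on small eigenvalues is controlled by the weights d, and the other part is nearly
tangent. The constant 13χ² is 12χ² for the near-tangent part plus 1 ≤ χ² for the small part. -/
theorem coercive_of_spectral_split {n m k r : ℕ} (hr : r < n) {χ ε T : ℝ}
    {A : Matrix (Fin m) (SymIdx n) ℝ} {Xs W V : Matrix (Fin n) (Fin n) ℝ} {w : Fin n → ℝ}
    {Us : Matrix (Fin n) (Fin k) ℝ} (hinj : TangentInjectivity χ A Xs Us)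
    (hE : IsOrderedEigendecomposition W V w) {P : Matrix (Fin n) (Fin n) ℝ}
    {B : Matrix (Fin k) (Fin n) ℝ} (hPs : Pᵀ = P) (hPi : P * P = P) (hPU : P = Us * B)
    (hε : ‖spectralProj V w T * (1 - P)‖ ^ 2 ≤ ε) (hεχ : 64 * χ ^ 2 * ε ≤ 1)
    (hA : ∀ x, (((CFC.sqrt (A * Aᵀ))⁻¹ * A) *ᵥ x) ⬝ᵥ (((CFC.sqrt (A * Aᵀ))⁻¹ * A) *ᵥ x) ≤ x ⬝ᵥ x)
    {d : LowRankIdx n r → ℝ} {d₀ : ℝ} (hd₀ : 0 < d₀) (hd₁ : d₀ ≤ 1) (hd : ∀ j, 0 ≤ d j)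
    (hsmall : ∀ j, w (pairIdx hr j).1.1 ≤ T → d₀ ≤ d j) (h : LowRankIdx n r → ℝ) :
    h ⬝ᵥ h ≤ 13 * χ ^ 2 / d₀ * (∑ j, d j * h j ^ 2 +
      ((CFC.sqrt (A * Aᵀ))⁻¹ *ᵥ ((A * lowRankFactor hr V) *ᵥ h)) ⬝ᵥ
        ((CFC.sqrt (A * Aᵀ))⁻¹ *ᵥ ((A * lowRankFactor hr V) *ᵥ h))) := by
  classical
  set h₁ : LowRankIdx n r → ℝ := fun j => if w (pairIdx hr j).1.1 ≤ T then 0 else h j with hh₁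
  set h₂ : LowRankIdx n r → ℝ := fun j => if w (pairIdx hr j).1.1 ≤ T then h j else 0 with hh₂
  have hadd : h₁ + h₂ = h := by
    ext j; simp only [hh₁, hh₂, Pi.add_apply]; split_ifs <;> simp
  have hsum : h ⬝ᵥ h = h₁ ⬝ᵥ h₁ + h₂ ⬝ᵥ h₂ := by
    simp only [dotProduct, ← Finset.sum_add_distrib]
    refine Finset.sum_congr rfl fun j _ => ?_
    simp only [hh₁, hh₂]; split_ifs <;> simp
  have h2le : d₀ * (h₂ ⬝ᵥ h₂) ≤ ∑ j, d j * h j ^ 2 := by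
    rw [dotProduct, Finset.mul_sum]
    refine Finset.sum_le_sum fun j _ => ?_
    simp only [hh₂]
    split_ifs with hj
    · rw [← sq]; exact mul_le_mul_of_nonneg_right (hsmall j hj) (sq_nonneg _)
    · simpa using mul_nonneg (hd j) (sq_nonneg (h j))
  have key := coercive_of_near_tangent hinj hPs hPi hPU (spectralProj_transpose T)
    (hE.spectralProj_mul_self T) hε hεχ hA (lowRankMat_transpose hr V h₁)
    (lowRankMat_transpose hr V h₂)
    (one_sub_spectralProj_mul_lowRankMat hr hE (h := h₁) fun j hj => by simp [hh₁, hj])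
  rw [← lowRankMat_add, hadd, ← lowRankFactor_mulVec, frobSq_lowRankMat hr hE.orthonormal,
    frobSq_lowRankMat hr hE.orthonormal] at key
  have hassoc : ((CFC.sqrt (A * Aᵀ))⁻¹ * A) *ᵥ (lowRankFactor hr V *ᵥ h) =
      (CFC.sqrt (A * Aᵀ))⁻¹ *ᵥ ((A * lowRankFactor hr V) *ᵥ h) := by
    simp only [Matrix.mulVec_mulVec, Matrix.mul_assoc]
  rw [hassoc] at key
  set q := ((CFC.sqrt (A * Aᵀ))⁻¹ *ᵥ ((A * lowRankFactor hr V) *ᵥ h)) ⬝ᵥ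
        ((CFC.sqrt (A * Aᵀ))⁻¹ *ᵥ ((A * lowRankFactor hr V) *ᵥ h)) with hq
  have hq0 : 0 ≤ q := dotProduct_self_nonneg_real _
  have h20 := dotProduct_self_nonneg_real h₂
  have hχ : 1 ≤ χ ^ 2 := one_le_pow₀ hinj.one_le
  rw [div_mul_eq_mul_div, le_div_iff₀ hd₀, hsum]
  have h3 : d₀ * (h₁ ⬝ᵥ h₁) ≤ 12 * χ ^ 2 * (q + d₀ * (h₂ ⬝ᵥ h₂)) := by
    calc d₀ * (h₁ ⬝ᵥ h₁) ≤ d₀ * (12 * χ ^ 2 * (q + h₂ ⬝ᵥ h₂)) :=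
          mul_le_mul_of_nonneg_left key hd₀.le
      _ = 12 * χ ^ 2 * (d₀ * q + d₀ * (h₂ ⬝ᵥ h₂)) := by ring
      _ ≤ _ := by
        have : d₀ * q ≤ q := mul_le_of_le_one_left hq0 hd₁
        gcongr
  nlinarith [mul_le_mul_of_nonneg_left h2le (by positivity : (0:ℝ) ≤ χ ^ 2),
    mul_nonneg (by positivity : (0:ℝ) ≤ χ ^ 2) hq0, mul_nonneg hd₀.le h20]

end Coercivity

/-! ### A priori estimates for regularized saddle-point matrices -/

section SaddlePoint

variable {ι κ : Type*} [Fintype ι] [DecidableEq ι] [Fintype κ] [DecidableEq κ]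

theorem isUnit_sqrt_of_posDef {M : Matrix ι ι ℝ} (hM : M.PosDef) : IsUnit (CFC.sqrt M) := by
  have h := CFC.sqrt_mul_sqrt_self M (Matrix.nonneg_iff_posSemidef.2 hM.posSemidef)
  exact isUnit_of_mul_isUnit_left (h ▸ hM.isUnit)

theorem sqrt_inv_mulVec_cancel {M : Matrix ι ι ℝ} (hM : M.PosDef) (x : ι → ℝ) :
    (CFC.sqrt M)⁻¹ *ᵥ (CFC.sqrt M *ᵥ x) = x := by
  rw [Matrix.mulVec_mulVec, Matrix.nonsing_inv_mul _
    ((Matrix.isUnit_iff_isUnit_det _).1 (isUnit_sqrt_of_posDef hM)), Matrix.one_mulVec]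

theorem sqrt_mulVec_inv_cancel {M : Matrix ι ι ℝ} (hM : M.PosDef) (x : ι → ℝ) :
    CFC.sqrt M *ᵥ ((CFC.sqrt M)⁻¹ *ᵥ x) = x := by
  rw [Matrix.mulVec_mulVec, Matrix.mul_nonsing_inv _
    ((Matrix.isUnit_iff_isUnit_det _).1 (isUnit_sqrt_of_posDef hM)), Matrix.one_mulVec]

theorem sqrt_inv_transpose (M : Matrix ι ι ℝ) : ((CFC.sqrt M)⁻¹)ᵀ = (CFC.sqrt M)⁻¹ := by
  rw [Matrix.transpose_nonsing_inv, sqrt_transpose]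

theorem sqrt_inv_mulVec_dotProduct_self_le {M : Matrix ι ι ℝ} (hM : M.PosDef) (f : ι → ℝ) :
    ((CFC.sqrt M)⁻¹ *ᵥ f) ⬝ᵥ ((CFC.sqrt M)⁻¹ *ᵥ f) ≤ ‖M⁻¹‖ * (f ⬝ᵥ f) := by
  rw [mulVec_dotProduct_eq, sqrt_inv_transpose, Matrix.mulVec_mulVec, ← Matrix.mul_inv_rev,
    CFC.sqrt_mul_sqrt_self M (Matrix.nonneg_iff_posSemidef.2 hM.posSemidef)]
  exact (le_abs_self _).trans (abs_quadForm_le _ _)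

theorem dotProduct_self_le_inv_norm_mul {M : Matrix ι ι ℝ} (hM : M.PosDef) (x : ι → ℝ) :
    x ⬝ᵥ x ≤ ‖M⁻¹‖ * (x ⬝ᵥ M *ᵥ x) := by
  have h := sqrt_inv_mulVec_dotProduct_self_le hM (CFC.sqrt M *ᵥ x)
  rwa [sqrt_inv_mulVec_cancel hM, ← quadForm_eq_sqrt hM.posSemidef] at h

theorem posSemidef_of_sub_smul {ι : Type*} {M G : Matrix ι ι ℝ} (hM : M.PosSemidef) {γ : ℝ} (hγ : 0 ≤ γ)
    (hG : (G - γ • M).PosSemidef) : G.PosSemidef := by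
  simpa using hG.add (hM.smul hγ)

/-- K = M^{-1/2} G M^{-1/2} satisfies 0 ⪯ K ⪯ γ, so |Ky|² ≤ γ yᵀKy; take y = M^{1/2}x. -/
theorem sqrt_inv_mulVec_mulVec_dotProduct_self_le {M G : Matrix ι ι ℝ} (hM : M.PosDef)
    (hG : G.PosSemidef) {γ : ℝ} (hGM : (γ • M - G).PosSemidef) (x : ι → ℝ) :
    ((CFC.sqrt M)⁻¹ *ᵥ (G *ᵥ x)) ⬝ᵥ ((CFC.sqrt M)⁻¹ *ᵥ (G *ᵥ x)) ≤ γ * (x ⬝ᵥ G *ᵥ x) := by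
  set N := (CFC.sqrt M)⁻¹ with hN
  have hNt : Nᵀ = N := sqrt_inv_transpose M
  have hK : (N * G * N).PosSemidef := by
    have := hG.conjTranspose_mul_mul_same N
    rwa [Matrix.conjTranspose_eq_transpose_of_trivial, hNt] at this
  have hquad : ∀ v, v ⬝ᵥ (N * G * N) *ᵥ v = (N *ᵥ v) ⬝ᵥ G *ᵥ (N *ᵥ v) := fun v => by
    rw [mulVec_dotProduct_eq, hNt, Matrix.mulVec_mulVec, Matrix.mulVec_mulVec, Matrix.mul_assoc]
  have hle : ∀ v, v ⬝ᵥ (N * G * N) *ᵥ v ≤ γ * (v ⬝ᵥ v) := fun v => by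
    rw [hquad]
    refine (quadForm_le_of_sub_posSemidef hGM _).trans (le_of_eq ?_)
    rw [Matrix.smul_mulVec, dotProduct_smul, quadForm_eq_sqrt hM.posSemidef,
      sqrt_mulVec_inv_cancel hM, smul_eq_mul]
  have h := mulVec_dotProduct_self_le_of_posSemidef hK hle (CFC.sqrt M *ᵥ x)
  rw [hquad, ← Matrix.mulVec_mulVec, ← Matrix.mulVec_mulVec, sqrt_inv_mulVec_cancel hM] at h
  exact h

theorem fromBlocks_mulVec_elim {ι : Type*} [Fintype ι] (G : Matrix ι ι ℝ) (B : Matrix ι κ ℝ) (d : κ → ℝ)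
    (x : ι → ℝ) (h : κ → ℝ) :
    Matrix.fromBlocks G B Bᵀ (-Matrix.diagonal d) *ᵥ Sum.elim x h =
      Sum.elim (G *ᵥ x + B *ᵥ h) (Bᵀ *ᵥ x - fun j => d j * h j) := by
  rw [Matrix.fromBlocks_mulVec]
  congr 1
  ext j
  simp [Matrix.mulVec_diagonal, sub_eq_add_neg]

/-- A priori estimate for a regularized saddle-point system. -/
theorem euclNorm_le_saddlePoint {M G : Matrix ι ι ℝ} (hM : M.PosDef) {γmin γmax C : ℝ}
    (hγmin : 0 < γmin) (hγmax : 0 ≤ γmax) (hC : 0 ≤ C) (hGu : (γmax • M - G).PosSemidef)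
    (hGl : (G - γmin • M).PosSemidef) {B : Matrix ι κ ℝ} {d : κ → ℝ} (hd : ∀ j, 0 ≤ d j)
    (hcoer : ∀ h, h ⬝ᵥ h ≤ C * (∑ j, d j * h j ^ 2 +
      ((CFC.sqrt M)⁻¹ *ᵥ (B *ᵥ h)) ⬝ᵥ ((CFC.sqrt M)⁻¹ *ᵥ (B *ᵥ h)))) (z : ι ⊕ κ → ℝ) :
    euclNorm z ≤ (‖M⁻¹‖ * γmin⁻¹ + ‖M⁻¹‖ + (2 + 2 * γmax) * C) *
      euclNorm (Matrix.fromBlocks G B Bᵀ (-Matrix.diagonal d) *ᵥ z) := by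
  obtain ⟨x, h, rfl⟩ : ∃ x h, z = Sum.elim x h := ⟨z ∘ Sum.inl, z ∘ Sum.inr, by simp⟩
  have hG := posSemidef_of_sub_smul hM.posSemidef hγmin.le hGl
  rw [fromBlocks_mulVec_elim]
  set f := G *ᵥ x + B *ᵥ h with hf
  set g := Bᵀ *ᵥ x - (fun j => d j * h j) with hg
  set F := euclNorm (Sum.elim f g) with hF
  set Z := euclNorm (Sum.elim x h) with hZ
  set b := ‖M⁻¹‖ with hb
  have hb0 : 0 ≤ b := norm_nonneg _
  have hF0 : 0 ≤ F := euclNorm_nonneg _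
  have hZ0 : 0 ≤ Z := euclNorm_nonneg _
  have hF2 : F ^ 2 = f ⬝ᵥ f + g ⬝ᵥ g := euclNorm_elim_sq f g
  have hZ2 : Z ^ 2 = x ⬝ᵥ x + h ⬝ᵥ h := euclNorm_elim_sq x h
  set eG := x ⬝ᵥ G *ᵥ x with heG
  set eD := ∑ j, d j * h j ^ 2 with heD
  have heG0 : 0 ≤ eG := quadForm_nonneg hG x
  have heD0 : 0 ≤ eD := Finset.sum_nonneg fun j _ => mul_nonneg (hd j) (sq_nonneg _)
  -- Flipping the sign of g cancels the terms xᵀBh and makes both diagonal blocks contribute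
  -- positively.
  have henergy : eG + eD ≤ Z * F := by
    have h1 : eG + eD = Sum.elim x h ⬝ᵥ Sum.elim f (-g) := by
      have h2 : Sum.elim x h ⬝ᵥ Sum.elim f (-g) = x ⬝ᵥ f - h ⬝ᵥ g := by
        simp [dotProduct, sub_eq_add_neg]
      have h3 : h ⬝ᵥ (fun j => d j * h j) = eD :=
        Finset.sum_congr rfl fun j _ => by ring
      have h4 : h ⬝ᵥ Bᵀ *ᵥ x = x ⬝ᵥ B *ᵥ h := by
        rw [← mulVec_dotProduct_eq, dotProduct_comm]
      rw [h2, hf, hg, dotProduct_add, dotProduct_sub, h3, h4]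
      ring
    have h5 : euclNorm (Sum.elim f (-g)) = F := by
      have : euclNorm (Sum.elim f (-g)) ^ 2 = F ^ 2 := by
        rw [euclNorm_elim_sq, hF2]; simp
      exact (pow_left_inj₀ (euclNorm_nonneg _) hF0 two_ne_zero).1 this
    rw [h1, ← h5]
    exact (le_abs_self _).trans (abs_dotProduct_le _ _)
  have hx : x ⬝ᵥ x ≤ b * γmin⁻¹ * (Z * F) := by
    have h1 := dotProduct_self_le_inv_norm_mul hM x
    have h2 := quadForm_le_of_sub_posSemidef hGl x
    rw [Matrix.smul_mulVec, dotProduct_smul, smul_eq_mul] at h2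
    have h3 : x ⬝ᵥ M *ᵥ x ≤ γmin⁻¹ * (Z * F) := by
      rw [inv_mul_eq_div, le_div_iff₀ hγmin]; linarith
    calc x ⬝ᵥ x ≤ b * (x ⬝ᵥ M *ᵥ x) := h1
      _ ≤ b * (γmin⁻¹ * (Z * F)) := mul_le_mul_of_nonneg_left h3 hb0
      _ = _ := by ring
  have hh : h ⬝ᵥ h ≤ C * ((1 + 2 * γmax) * (Z * F) + 2 * b * F ^ 2) := by
    refine (hcoer h).trans (mul_le_mul_of_nonneg_left ?_ hC)
    have h1 : B *ᵥ h = f - G *ᵥ x := by rw [hf]; abel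
    rw [h1, Matrix.mulVec_sub]
    have h2 := dotProduct_sub_self_le ((CFC.sqrt M)⁻¹ *ᵥ f) ((CFC.sqrt M)⁻¹ *ᵥ (G *ᵥ x))
    have h3 := sqrt_inv_mulVec_dotProduct_self_le hM f
    have h4 := sqrt_inv_mulVec_mulVec_dotProduct_self_le hM hG hGu x
    have h5 : b * (f ⬝ᵥ f) ≤ b * F ^ 2 := mul_le_mul_of_nonneg_left
      (by rw [hF2]; linarith [dotProduct_self_nonneg_real g]) hb0
    have h6 : γmax * eG ≤ γmax * (Z * F) := mul_le_mul_of_nonneg_left (by linarith) hγmax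
    linarith
  set α := b * γmin⁻¹ + C * (1 + 2 * γmax) with hα
  have hα0 : 0 ≤ α := by positivity
  have hquad : Z ^ 2 ≤ α * (Z * F) + (b + C) ^ 2 * F ^ 2 := by
    have : 2 * b * C * F ^ 2 ≤ (b + C) ^ 2 * F ^ 2 :=
      mul_le_mul_of_nonneg_right (by nlinarith [sq_nonneg b, sq_nonneg C]) (sq_nonneg _)
    rw [hZ2]; linarith
  -- Z² ≤ αZF + s²F² with s = b + C forces Z ≤ (α + s)F: otherwise Z > sF, so s²F² ≤ sFZ and Z² ≤ (α
  -- + s)FZ.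
  have hgoal : Z ≤ (α + (b + C)) * F := by
    by_contra hcon
    push Not at hcon
    have hs : 0 ≤ b + C := by positivity
    have h1 : (b + C) * F < Z := lt_of_le_of_lt (by nlinarith [mul_nonneg hα0 hF0]) hcon
    have hZpos : 0 < Z := lt_of_le_of_lt (by positivity) h1
    have h2 : (α + (b + C)) * F * Z < Z * Z := mul_lt_mul_of_pos_right hcon hZpos
    have h3 : (b + C) * F * ((b + C) * F) ≤ (b + C) * F * Z :=
      mul_le_mul_of_nonneg_left h1.le (by positivity)
    nlinarith
  refine hgoal.trans (le_of_eq ?_)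
  rw [hα]; ring

theorem isUnit_and_norm_inv_le_of_euclNorm_le {M : Matrix ι ι ℝ} {c : ℝ} (hc : 0 ≤ c)
    (h : ∀ z, euclNorm z ≤ c * euclNorm (M *ᵥ z)) : IsUnit M ∧ ‖M⁻¹‖ ≤ c := by
  have hu : IsUnit M := by
    rw [← Matrix.mulVec_injective_iff_isUnit]
    intro u v huv
    have h1 := h (u - v)
    rw [Matrix.mulVec_sub, sub_eq_zero.2 huv] at h1
    have h2 : euclNorm (0 : ι → ℝ) = 0 := by simp [euclNorm]
    rw [h2, mul_zero] at h1
    have h3 := euclNorm_sq (u - v)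
    rw [le_antisymm h1 (euclNorm_nonneg _), sq, zero_mul] at h3
    exact sub_eq_zero.1 (dotProduct_self_eq_zero.1 h3.symm)
  refine ⟨hu, opNorm_le_of_euclNorm_le hc fun v => ?_⟩
  have h1 := h (M⁻¹ *ᵥ v)
  rwa [Matrix.mulVec_mulVec, Matrix.mul_nonsing_inv _ ((Matrix.isUnit_iff_isUnit_det _).1 hu),
    Matrix.one_mulVec] at h1

theorem opNorm_le_of_posSemidef {G : Matrix ι ι ℝ} (hG : G.PosSemidef) {c : ℝ} (hc : 0 ≤ c)
    (h : ∀ v, v ⬝ᵥ G *ᵥ v ≤ c * (v ⬝ᵥ v)) : ‖G‖ ≤ c := by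
  have : ‖G‖ ^ 2 ≤ c ^ 2 := opNorm_sq_le_of_dotProduct_le (sq_nonneg c) fun v => by
    refine (mulVec_dotProduct_self_le_of_posSemidef hG h v).trans ?_
    nlinarith [mul_le_mul_of_nonneg_left (h v) hc]
  exact le_of_sq_le_sq this hc

theorem opNorm_saddlePoint_le (G : Matrix ι ι ℝ) (B : Matrix ι κ ℝ) {d : κ → ℝ} {c : ℝ}
    (hc : 0 ≤ c) (hd : ∀ j, 0 ≤ d j) (hdc : ∀ j, d j ≤ c) :
    ‖Matrix.fromBlocks G B Bᵀ (-Matrix.diagonal d)‖ ≤ ‖G‖ + 2 * ‖B‖ + c := by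
  refine opNorm_le_of_euclNorm_le (by positivity) fun z => ?_
  obtain ⟨x, h, rfl⟩ : ∃ x h, z = Sum.elim x h := ⟨z ∘ Sum.inl, z ∘ Sum.inr, by simp⟩
  rw [fromBlocks_mulVec_elim]
  have hZ2 := euclNorm_elim_sq x h
  set Z := euclNorm (Sum.elim x h) with hZ
  have hZ0 : 0 ≤ Z := euclNorm_nonneg _
  have hx : euclNorm x ≤ Z := euclNorm_le_of_sq_le hZ0
    (by rw [hZ2]; linarith [dotProduct_self_nonneg_real h])
  have hh : euclNorm h ≤ Z := euclNorm_le_of_sq_le hZ0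
    (by rw [hZ2]; linarith [dotProduct_self_nonneg_real x])
  have hdh : euclNorm (-fun j => d j * h j) ≤ c * euclNorm h := by
    refine euclNorm_le_of_sq_le (mul_nonneg hc (euclNorm_nonneg _)) ?_
    rw [mul_pow, euclNorm_sq, neg_dotProduct_neg, dotProduct, dotProduct, Finset.mul_sum]
    refine Finset.sum_le_sum fun j _ => ?_
    have : d j ^ 2 ≤ c ^ 2 := pow_le_pow_left₀ (hd j) (hdc j) 2
    nlinarith [mul_le_mul_of_nonneg_right this (sq_nonneg (h j))]
  set f := G *ᵥ x + B *ᵥ h with hf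
  set g := Bᵀ *ᵥ x - (fun j => d j * h j) with hg
  have h1 : euclNorm f ≤ ‖G‖ * Z + ‖B‖ * Z :=
    (euclNorm_add_le _ _).trans (add_le_add
      ((euclNorm_mulVec_le _ _).trans (mul_le_mul_of_nonneg_left hx (norm_nonneg _)))
      ((euclNorm_mulVec_le _ _).trans (mul_le_mul_of_nonneg_left hh (norm_nonneg _))))
  have h2 : euclNorm g ≤ ‖B‖ * Z + c * Z := by
    rw [hg, sub_eq_add_neg]
    refine (euclNorm_add_le _ _).trans (add_le_add ?_
      (hdh.trans (mul_le_mul_of_nonneg_left hh hc)))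
    rw [← opNorm_transpose B]
    exact (euclNorm_mulVec_le _ _).trans (mul_le_mul_of_nonneg_left hx (norm_nonneg _))
  have h3 : euclNorm (Sum.elim f g) ≤ euclNorm f + euclNorm g := by
    have hf0 := euclNorm_nonneg f
    have hg0 := euclNorm_nonneg g
    refine le_of_sq_le_sq ?_ (by positivity)
    rw [euclNorm_elim_sq, ← euclNorm_sq, ← euclNorm_sq]
    nlinarith [mul_nonneg hf0 hg0]
  linarith

end SaddlePoint

/-! ### The Gram matrix of the constraints -/

section ConstraintMatrix

/-- The form at v is the squared norm of svec(Σ vᵢAᵢ), and svec is injective on symmetric matrices.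
-/
theorem constraintMatrix_gram_posDef {n m : ℕ} {A : Fin m → Matrix (Fin n) (Fin n) ℝ}
    (hA : ∀ i, (A i).IsSymm) (hind : LinearIndependent ℝ A) :
    (constraintMatrix A * (constraintMatrix A)ᵀ).PosDef := by
  refine Matrix.PosDef.of_dotProduct_mulVec_pos ?_ fun v hv => ?_
  · have := Matrix.isHermitian_mul_conjTranspose_self (constraintMatrix A)
    rwa [Matrix.conjTranspose_eq_transpose_of_trivial] at this
  · let f : Matrix (Fin n) (Fin n) ℝ →ₗ[ℝ] (SymIdx n → ℝ) :=
      { toFun := svec, map_add' := svec_add, map_smul' := svec_smul }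
    have h1 : (constraintMatrix A)ᵀ *ᵥ v = svec (∑ i, v i • A i) := by
      have h2 : svec (∑ i, v i • A i) = ∑ i, v i • svec (A i) := by
        change f _ = ∑ i, v i • f (A i)
        simp
      rw [h2]
      ext q
      simp [Matrix.mulVec, dotProduct, constraintMatrix, mul_comm]
    have h3 : star v ⬝ᵥ (constraintMatrix A * (constraintMatrix A)ᵀ) *ᵥ v =
        svec (∑ i, v i • A i) ⬝ᵥ svec (∑ i, v i • A i) := by
      rw [← h1, mulVec_dotProduct_eq, Matrix.transpose_transpose, Matrix.mulVec_mulVec, star_trivial]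
    rw [h3]
    refine lt_of_le_of_ne (dotProduct_self_nonneg_real _) fun h0 => hv ?_
    have h4 : (∑ i, v i • A i) = 0 := by
      refine eq_of_svec_eq ?_ (by simp) ?_
      · rw [Matrix.transpose_sum]
        exact Finset.sum_congr rfl fun i _ => by rw [Matrix.transpose_smul, (hA i).eq]
      · rw [dotProduct_self_eq_zero.1 h0.symm]
        exact (map_zero f).symm
    ext i
    exact Fintype.linearIndependent_iff.1 hind v h4 i

/-- (𝐀𝐀ᵀ)^{-1/2}𝐀 has orthonormal rows. -/
theorem gram_sqrt_inv_mul_contraction {m : ℕ} {κ : Type*} [Fintype κ] [DecidableEq κ]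
    {A : Matrix (Fin m) κ ℝ} (hM : (A * Aᵀ).PosDef) (x : κ → ℝ) :
    (((CFC.sqrt (A * Aᵀ))⁻¹ * A) *ᵥ x) ⬝ᵥ (((CFC.sqrt (A * Aᵀ))⁻¹ * A) *ᵥ x) ≤ x ⬝ᵥ x := by
  set N := (CFC.sqrt (A * Aᵀ))⁻¹ with hN
  have h1 : (N * A) * (N * A)ᵀ = 1 := by
    have hd := (Matrix.isUnit_iff_isUnit_det _).1 (isUnit_sqrt_of_posDef hM)
    have hs := CFC.sqrt_mul_sqrt_self _ (Matrix.nonneg_iff_posSemidef.2 hM.posSemidef)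
    rw [Matrix.transpose_mul, sqrt_inv_transpose, ← hN]
    calc N * A * (Aᵀ * N) = N * (A * Aᵀ) * N := by simp only [Matrix.mul_assoc]
      _ = (N * CFC.sqrt (A * Aᵀ)) * (CFC.sqrt (A * Aᵀ) * N) := by
        conv_lhs => rw [← hs]
        simp only [Matrix.mul_assoc]
      _ = 1 := by rw [hN, Matrix.nonsing_inv_mul _ hd, Matrix.mul_nonsing_inv _ hd, Matrix.mul_one]
  have h2 : ‖N * A‖ ^ 2 ≤ 1 := by
    rw [← opNorm_mul_transpose_self, h1]
    refine opNorm_le_of_euclNorm_le zero_le_one fun v => by simp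
  exact (mulVec_dotProduct_self_le _ _).trans
    (mul_le_of_le_one_left (dotProduct_self_nonneg_real _) h2)

end ConstraintMatrix

/-! ### Upper and lower bounds for the regularization block τ²𝚺 -/

section RegularizationBlock

/-- The reciprocal diagonal entries of `lowRankSigma`. -/
noncomputable def sigmaDenom {n r : ℕ} (hr : r < n) (w : Fin n → ℝ) (τ : ℝ) :
    LowRankIdx n r → ℝ :=
  Sum.elim (fun q => w (pairIdx hr (Sum.inl q)).1.1 * w (pairIdx hr (Sum.inl q)).1.2 - τ ^ 2)
    fun p => (w (pairIdx hr (Sum.inr p)).1.1 - τ) * w (pairIdx hr (Sum.inr p)).1.2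

theorem lowRankSigma_eq {n r : ℕ} (hr : r < n) (w : Fin n → ℝ) (τ : ℝ)
    (hne : ∀ j, sigmaDenom hr w τ j ≠ 0) :
    lowRankSigma hr w τ = Matrix.diagonal fun j => (sigmaDenom hr w τ j)⁻¹ := by
  have h1 : Matrix.fromBlocks (skron (topEig hr w) (topEig hr w) - τ ^ 2 • 1) 0 0
      ((topEig hr w - τ • 1) ⊗ₖ (botEig w : Matrix _ (Fin (n - r)) ℝ)) =
      Matrix.diagonal (sigmaDenom hr w τ) := by
    rw [topEig, botEig, skron_diagonal, Matrix.smul_one_eq_diagonal, Matrix.smul_one_eq_diagonal,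
      Matrix.diagonal_sub, Matrix.diagonal_sub, Matrix.diagonal_kronecker_diagonal,
      Matrix.fromBlocks_diagonal]
    rfl
  rw [lowRankSigma, h1]
  refine Matrix.inv_eq_right_inv ?_
  rw [Matrix.diagonal_mul_diagonal, ← Matrix.diagonal_one]
  congr 1; ext j
  exact mul_inv_cancel₀ (hne j)

variable {n r : ℕ} {hr : r < n} {w : Fin n → ℝ} {τ : ℝ}

theorem top_eigenvalue_ge (hw : Antitone w) (hτ : τ = (1 / 2) * w ⟨r, hr⟩) (i : Fin r) :
    2 * τ ≤ w (Fin.castLE hr.le i) := by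
  have : w ⟨r, hr⟩ ≤ w (Fin.castLE hr.le i) := hw (by rw [Fin.le_def]; exact i.2.le)
  linarith

theorem sigmaDenom_pos (hw : Antitone w) (hpos : ∀ i, 0 < w i)
    (hτ : τ = (1 / 2) * w ⟨r, hr⟩) (j : LowRankIdx n r) : 0 < sigmaDenom hr w τ j := by
  have hτ0 : 0 < τ := by rw [hτ]; linarith [hpos ⟨r, hr⟩]
  rcases j with q | p
  · have h1 := top_eigenvalue_ge hw hτ q.1.1
    have h2 := top_eigenvalue_ge hw hτ q.1.2
    simp only [sigmaDenom, Sum.elim_inl, pairIdx]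
    nlinarith
  · have h1 := top_eigenvalue_ge hw hτ p.1
    simp only [sigmaDenom, Sum.elim_inr, pairIdx]
    exact mul_pos (by linarith) (hpos _)

/-- Both eigenvalues of the pair are then at most T, and subtracting τ² or τ only decreases the
product. This bounds τ²𝚺 from below. -/
theorem sigmaDenom_le_sq (hw : Antitone w) (hpos : ∀ i, 0 < w i)
    (hτ : τ = (1 / 2) * w ⟨r, hr⟩) {T : ℝ} (j : LowRankIdx n r)
    (hj : w (pairIdx hr j).1.1 ≤ T) : sigmaDenom hr w τ j ≤ T ^ 2 := by
  have hτ0 : 0 < τ := by rw [hτ]; linarith [hpos ⟨r, hr⟩]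
  have h1 := hpos (pairIdx hr j).1.1
  have h2 := hpos (pairIdx hr j).1.2
  have h3 : w (pairIdx hr j).1.2 ≤ w (pairIdx hr j).1.1 := hw (pairIdx hr j).2
  rcases j with q | p
  · simp only [sigmaDenom, Sum.elim_inl]
    nlinarith
  · simp only [sigmaDenom, Sum.elim_inr]
    nlinarith

/-- Since τ is half of the (r+1)-st eigenvalue, the top ones are at least 2τ. So ΛᵢΛⱼ - τ² ≥ 3τ²,
and the mixed entries are at least τ times a bottom eigenvalue, hence at least τ²/c. -/
theorem sq_div_sigmaDenom_le (hw : Antitone w) (hpos : ∀ i, 0 < w i)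
    (hτ : τ = (1 / 2) * w ⟨r, hr⟩) {c : ℝ} (hc : 1 ≤ c) (hwc : ∀ i, τ ≤ c * w i)
    (j : LowRankIdx n r) : τ ^ 2 * (sigmaDenom hr w τ j)⁻¹ ≤ c := by
  have hτ0 : 0 < τ := by rw [hτ]; linarith [hpos ⟨r, hr⟩]
  rw [← div_eq_mul_inv, div_le_iff₀ (sigmaDenom_pos hw hpos hτ j)]
  rcases j with q | p
  · have h1 := top_eigenvalue_ge hw hτ q.1.1
    have h2 := top_eigenvalue_ge hw hτ q.1.2
    simp only [sigmaDenom, Sum.elim_inl, pairIdx]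
    have h3 : τ ^ 2 ≤ w (Fin.castLE hr.le q.1.1) * w (Fin.castLE hr.le q.1.2) - τ ^ 2 := by
      nlinarith
    exact h3.trans (le_mul_of_one_le_left ((sq_nonneg τ).trans h3) hc)
  · have h1 := top_eigenvalue_ge hw hτ p.1
    simp only [sigmaDenom, Sum.elim_inr, pairIdx]
    have h2 := hwc (botIdx p.2)
    nlinarith [mul_le_mul_of_nonneg_left h2 hτ0.le,
      mul_nonneg (mul_nonneg (by linarith : (0:ℝ) ≤ c) (hpos (botIdx p.2)).le)
        (by linarith : 0 ≤ w (Fin.castLE hr.le p.1) - τ - τ)]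

end RegularizationBlock

/-! ### Assembling the condition number bound -/

section ConditionNumber

/-- max(1, 1/a) · a = max(1, a), applied to both norms. The products max(1, ‖M‖) and max(1, ‖M⁻¹‖)
are what the estimates produce. -/
theorem scaleFactor_mul_condNumber {ι : Type*} [Fintype ι] [DecidableEq ι] {M : Matrix ι ι ℝ}
    (h1 : 0 < ‖M‖) (h2 : 0 < ‖M⁻¹‖) :
    scaleFactor M * condNumber M = max 1 ‖M‖ * max 1 ‖M⁻¹‖ := by
  have key : ∀ a : ℝ, 0 < a → max 1 a⁻¹ * a = max 1 a := fun a ha => by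
    rw [max_mul_of_nonneg _ _ ha.le, inv_mul_cancel₀ ha.ne', one_mul, max_comm]
  rw [scaleFactor, condNumber, ← key _ h1, ← key _ h2]; ring

theorem condNumber_arith {N N' a b γmin γmax C L E χ χ₁ : ℝ} (hN' : 0 ≤ N')
    (ha : 1 ≤ a) (hb : 1 ≤ b) (hγmin : 0 < γmin) (hγ : γmin ≤ γmax) (hL : 1 ≤ L) (hE : 1 ≤ E)
    (hχ : 1 ≤ χ) (hχ₁ : 1 ≤ χ₁) (hN : N ≤ γmax * a + 2 * a + L ^ 2 * E ^ 2)
    (hNi : N' ≤ b * γmin⁻¹ + b + (2 + 2 * γmax) * C)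
    (hC : C = 851968 * (χ ^ 6 * L ^ 4 * E ^ 4)) :
    N * N' ≤ 24 * 851968 * (a * b) * γmax ^ 4 * (max 1 γmin⁻¹) ^ 8 * L ^ 12 * E ^ 11 *
      χ₁ ^ 2 * χ ^ 6 := by
  set g := max 1 γmin⁻¹ with hg
  have hg1 : 1 ≤ g := le_max_left _ _
  have hgi : γmin⁻¹ ≤ g := le_max_right _ _
  set p := γmax * g with hp
  have hγmax : 0 < γmax := hγmin.trans_le hγ
  -- γmax itself may be below 1, so powers are raised only through p = γmax g ≥ 1 and g ≥ 1.
  have hp1 : 1 ≤ p := by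
    have : γmin * γmin⁻¹ = 1 := mul_inv_cancel₀ hγmin.ne'
    calc (1 : ℝ) = γmin * γmin⁻¹ := this.symm
      _ ≤ γmax * g := mul_le_mul hγ hgi (by positivity) hγmax.le
  have hγp : γmax ≤ p := le_mul_of_one_le_right hγmax.le hg1
  have one_le_mul' : ∀ {x y : ℝ}, 1 ≤ x → 1 ≤ y → 1 ≤ x * y := fun hx hy =>
    one_le_mul_of_one_le_of_one_le hx hy
  set l := L ^ 2 * E ^ 2 with hl
  have hl1 : 1 ≤ l := one_le_mul' (one_le_pow₀ hL) (one_le_pow₀ hE)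
  have hN2 : N ≤ 4 * (a * p * l) := by
    have e1 : γmax * a ≤ a * p * l := by
      calc γmax * a ≤ p * a := mul_le_mul_of_nonneg_right hγp (by linarith)
        _ = a * p := mul_comm _ _
        _ ≤ _ := le_mul_of_one_le_right (by positivity) hl1
    have e2 : a ≤ a * p * l := by
      rw [mul_assoc]; exact le_mul_of_one_le_right (by linarith) (one_le_mul' hp1 hl1)
    have e3 : l ≤ a * p * l := le_mul_of_one_le_left (by linarith) (one_le_mul' ha hp1)
    linarith
  set c := χ ^ 6 * L ^ 4 * E ^ 4 with hc
  have hc1 : 1 ≤ c := one_le_mul' (one_le_mul' (one_le_pow₀ hχ) (one_le_pow₀ hL))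
    (one_le_pow₀ hE)
  have hNi2 : N' ≤ 6 * 851968 * (b * (p * g) * c) := by
    have e0 : g ≤ p * g := le_mul_of_one_le_left (by linarith) hp1
    have e1 : b * γmin⁻¹ ≤ b * (p * g) * c := by
      calc b * γmin⁻¹ ≤ b * (p * g) := mul_le_mul_of_nonneg_left (hgi.trans e0) (by linarith)
        _ ≤ _ := le_mul_of_one_le_right (by positivity) hc1
    have e2 : b ≤ b * (p * g) * c := by
      rw [mul_assoc]
      exact le_mul_of_one_le_right (by linarith) (one_le_mul' (one_le_mul' hp1 hg1) hc1)
    have e3 : c ≤ b * (p * g) * c :=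
      le_mul_of_one_le_left (by linarith) (one_le_mul' hb (one_le_mul' hp1 hg1))
    have e4 : γmax * c ≤ b * (p * g) * c := by
      refine mul_le_mul_of_nonneg_right ?_ (by linarith)
      calc γmax ≤ p * g := hγp.trans (le_mul_of_one_le_right (by linarith) hg1)
        _ ≤ _ := le_mul_of_one_le_left (by positivity) hb
    rw [hC] at hNi
    linarith
  calc N * N' ≤ 4 * (a * p * l) * (6 * 851968 * (b * (p * g) * c)) :=
        mul_le_mul hN2 hNi2 hN' (by positivity)
    -- The estimates give these smaller exponents; the stated ones follow because every factor
    -- raised is at least 1.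
    _ = 24 * 851968 * (a * b) * (γmax ^ 2 * g ^ 3) * L ^ 6 * E ^ 6 * χ ^ 6 := by
        rw [hp, hl, hc]; ring
    _ ≤ 24 * 851968 * (a * b) * (γmax ^ 4 * g ^ 8) * L ^ 12 * E ^ 11 * χ₁ ^ 2 * χ ^ 6 := by
        have e1 : γmax ^ 2 * g ^ 3 ≤ γmax ^ 4 * g ^ 8 := by
          have : γmax ^ 4 * g ^ 8 = (γmax ^ 2 * g ^ 3) * (p ^ 2 * g ^ 3) := by rw [hp]; ring
          rw [this]
          exact le_mul_of_one_le_right (by positivity)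
            (one_le_mul' (one_le_pow₀ hp1) (one_le_pow₀ hg1))
        have e2 : L ^ 6 ≤ L ^ 12 := pow_le_pow_right₀ hL (by norm_num)
        have e3 : E ^ 6 ≤ E ^ 11 := pow_le_pow_right₀ hE (by norm_num)
        have e4 : 24 * 851968 * (a * b) * (γmax ^ 2 * g ^ 3) * L ^ 6 * E ^ 6 ≤
            24 * 851968 * (a * b) * (γmax ^ 4 * g ^ 8) * L ^ 12 * E ^ 11 := by gcongr
        have e5 : 24 * 851968 * (a * b) * (γmax ^ 4 * g ^ 8) * L ^ 12 * E ^ 11 ≤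
            24 * 851968 * (a * b) * (γmax ^ 4 * g ^ 8) * L ^ 12 * E ^ 11 * χ₁ ^ 2 :=
          le_mul_of_one_le_right (by positivity) (one_le_pow₀ hχ₁)
        exact mul_le_mul_of_nonneg_right (e4.trans e5) (by positivity)
    _ = _ := by ring

end ConditionNumber

/-! ### The well-conditioning theorem -/

theorem theorem1 :
    ∃ K : ℝ, 0 < K ∧
      ∀ (n m r k : ℕ) (hr : r < n) (_hm : 0 < m)
        (A : Fin m → Matrix (Fin n) (Fin n) ℝ)
        (_hAsymm : ∀ i, (A i).IsSymm) (_hAindep : LinearIndependent ℝ A)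
        (μ L δ χ₁ χ₂ : ℝ) (_hμ0 : 0 < μ) (_hμ1 : μ ≤ 1)
        (X S Xs Ss : Matrix (Fin n) (Fin n) ℝ)
        (_hcent : Centrality μ L δ χ₁ X S Xs Ss)
        (Us : Matrix (Fin n) (Fin k) ℝ)
        (_hinj : TangentInjectivity χ₂ (constraintMatrix A) Xs Us)
        (_hrank : Xs.rank ≤ r)
        (W V : Matrix (Fin n) (Fin n) ℝ) (w : Fin n → ℝ)
        (_hW : W = ntScaling X S) (_heig : IsOrderedEigendecomposition W V w)
        (τ : ℝ) (_hτ : τ = (1 / 2) * w ⟨r, hr⟩)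
        (γmin γmax : ℝ) (_hγmin : 0 < γmin) (_hγ : γmin ≤ γmax)
        (G : Matrix (Fin m) (Fin m) ℝ)
        (_hGupper : (γmax • (constraintMatrix A * (constraintMatrix A)ᵀ) - G).PosSemidef)
        (_hGlower : (G - γmin • (constraintMatrix A * (constraintMatrix A)ᵀ)).PosSemidef),
        IsUnit (augmentedMatrix hr (constraintMatrix A) G V w τ) ∧
        condNumber (augmentedMatrix hr (constraintMatrix A) G V w τ) ≤
          K * scaleFactor (constraintMatrix A * (constraintMatrix A)ᵀ)
            * condNumber (constraintMatrix A * (constraintMatrix A)ᵀ)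
            * γmax ^ 4 * (max 1 γmin⁻¹) ^ 8 * (max 1 L) ^ 12 * ((1 - δ)⁻¹) ^ 11
            * χ₁ ^ 2 * χ₂ ^ 6 := by
  refine ⟨24 * 851968, by norm_num, ?_⟩
  intro n m r k hr hm A hAsymm hAind μ L δ χ₁ χ₂ hμ hμ1 X S Xs Ss hcent Us hinj hrank W V w hW
    hE τ hτ γmin γmax hγmin hγ G hGu hGl
  subst hW
  set Ac := constraintMatrix A with hA
  set M := Ac * Acᵀ with hMdef
  have hM : M.PosDef := constraintMatrix_gram_posDef hAsymm hAind
  have hγmax : 0 < γmax := hγmin.trans_le hγ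
  have hG := posSemidef_of_sub_smul hM.posSemidef hγmin.le hGl
  have hδ : 0 < 1 - δ := sub_pos.2 hcent.δ_lt_one
  set e := 1 - δ with he
  have he1 : e ≤ 1 := by linarith [hcent.δ_nonneg]
  set l := max 1 L with hl
  have hl1 : 1 ≤ l := le_max_left _ _
  have hLl : L ≤ l := le_max_right _ _
  set σ := √μ with hσ
  have hσ0 : 0 < σ := Real.sqrt_pos.2 hμ
  have hχ : 1 ≤ χ₂ := hinj.one_le
  have hge := hcent.eigenvalue_ge hμ hE
  have hpos : ∀ i, 0 < w i := fun i => by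
    have h1 : 0 < 2 * l * w i := lt_of_lt_of_le (by positivity) (hge i)
    exact pos_of_mul_pos_right h1 (by positivity)
  have hwr : e * w ⟨r, hr⟩ ≤ l * σ :=
    (hcent.eigenvalue_le_of_rank_le hμ hE hr hrank).trans (by gcongr)
  have hτ0 : 0 < τ := by rw [hτ]; linarith [hpos ⟨r, hr⟩]
  set d : LowRankIdx n r → ℝ := fun j => τ ^ 2 * (sigmaDenom hr w τ j)⁻¹ with hd
  have hden := sigmaDenom_pos hE.antitone hpos hτ
  have hd0 : ∀ j, 0 ≤ d j := fun j => mul_nonneg (sq_nonneg _) (inv_nonneg.2 (hden j).le)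
  -- The ratio τ / wᵢ is free of μ: 2eτ ≤ lσ from above and eσ ≤ 2l wᵢ from below give τ ≤ (l/e)²
  -- wᵢ.
  have hdle : ∀ j, d j ≤ l ^ 2 * e⁻¹ ^ 2 := by
    refine sq_div_sigmaDenom_le hE.antitone hpos hτ ?_ fun i => ?_
    · exact one_le_mul_of_one_le_of_one_le (one_le_pow₀ hl1)
        (one_le_pow₀ ((one_le_inv₀ hδ).2 he1))
    · have h1 : e ^ 2 * τ ≤ l ^ 2 * w i := by
        have h2 : 2 * (e * τ) ≤ l * σ := by rw [hτ]; linarith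
        nlinarith [mul_le_mul_of_nonneg_left h2 hδ.le,
          mul_le_mul_of_nonneg_left (hge i) (by positivity : 0 ≤ l)]
      rw [inv_pow, ← div_eq_mul_inv, div_mul_eq_mul_div, le_div_iff₀ (by positivity)]
      linarith
  have haug : augmentedMatrix hr Ac G V w τ = Matrix.fromBlocks G (Ac * lowRankFactor hr V)
      (Ac * lowRankFactor hr V)ᵀ (-Matrix.diagonal d) := by
    rw [augmentedMatrix, lowRankSigma_eq hr w τ fun j => (hden j).ne', Matrix.transpose_mul,
      ← Matrix.diagonal_smul]
    rfl
  obtain ⟨P, B, hPs, hPi, hXP, hPU⟩ := exists_range_projection hcent.Xs_posSemidef.1 hinj.factor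
  -- The cutoff that makes the leakage Lσ/(eT) at most 1/(64χ₂²).
  set T := 64 * χ₂ ^ 2 * l * σ / e with hT
  have hT0 : 0 < T := by positivity
  have hε := hcent.spectralProj_mul_one_sub_le hμ hE hPs hPi hXP hT0
  have hεχ : 64 * χ₂ ^ 2 * (L * σ / (e * T)) ≤ 1 := by
    have h1 : e * T = 64 * χ₂ ^ 2 * l * σ := by rw [hT]; field_simp
    rw [h1, ← mul_div_assoc, div_le_one (by positivity)]
    calc 64 * χ₂ ^ 2 * (L * σ) ≤ 64 * χ₂ ^ 2 * (l * σ) := by gcongr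
      _ = _ := by ring
  -- A lower bound for (τ/T)², since τ ≥ eσ/(4l); the factor σ cancels, and with it μ.
  set d₀ := (e ^ 2 / (256 * l ^ 2 * χ₂ ^ 2)) ^ 2 with hd₀
  have hd₀pos : 0 < d₀ := by positivity
  have hd₀le : d₀ ≤ 1 := by
    refine pow_le_one₀ (by positivity) ?_
    rw [div_le_one (by positivity)]
    nlinarith [one_le_mul_of_one_le_of_one_le (one_le_pow₀ hl1 : 1 ≤ l ^ 2)
      (one_le_pow₀ hχ : 1 ≤ χ₂ ^ 2)]
  have hsmall : ∀ j, w (pairIdx hr j).1.1 ≤ T → d₀ ≤ d j := fun j hj => by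
    have h1 := sigmaDenom_le_sq hE.antitone hpos hτ j hj
    have h2 : e ^ 2 / (256 * l ^ 2 * χ₂ ^ 2) * T ≤ τ := by
      have h3 : e ^ 2 / (256 * l ^ 2 * χ₂ ^ 2) * T = e * σ / (4 * l) := by
        rw [hT]; field_simp; norm_num
      rw [h3, div_le_iff₀ (by positivity), hτ]
      linarith [hge ⟨r, hr⟩]
    change d₀ ≤ τ ^ 2 * (sigmaDenom hr w τ j)⁻¹
    rw [← div_eq_mul_inv, le_div_iff₀ (hden j)]
    calc d₀ * sigmaDenom hr w τ j ≤ d₀ * T ^ 2 := mul_le_mul_of_nonneg_left h1 hd₀pos.le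
      _ = (e ^ 2 / (256 * l ^ 2 * χ₂ ^ 2) * T) ^ 2 := by rw [hd₀, mul_pow]
      _ ≤ τ ^ 2 := pow_le_pow_left₀ (by positivity) h2 2
  have hcoer := coercive_of_spectral_split hr hinj hE hPs hPi hPU hε hεχ
    (gram_sqrt_inv_mul_contraction hM) hd₀pos hd₀le hd0 hsmall
  have hest := isUnit_and_norm_inv_le_of_euclNorm_le (by positivity)
    (euclNorm_le_saddlePoint hM hγmin hγmax.le (by positivity) hGu hGl hd0 hcoer)
  have hnorm := opNorm_saddlePoint_le G (Ac * lowRankFactor hr V) (c := l ^ 2 * e⁻¹ ^ 2)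
    (by positivity) hd0 hdle
  rw [← haug] at hest hnorm
  refine ⟨hest.1, ?_⟩
  have hGnorm : ‖G‖ ≤ γmax * ‖M‖ := opNorm_le_of_posSemidef hG (by positivity) fun v => by
    refine (quadForm_le_of_sub_posSemidef hGu v).trans ?_
    rw [Matrix.smul_mulVec, dotProduct_smul, smul_eq_mul, mul_assoc]
    exact mul_le_mul_of_nonneg_left ((le_abs_self _).trans (abs_quadForm_le _ _)) hγmax.le
  have hBnorm : ‖Ac * lowRankFactor hr V‖ ≤ max 1 ‖M‖ := by
    have h1 : ‖Ac * lowRankFactor hr V‖ ^ 2 ≤ ‖M‖ :=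
      opNorm_sq_le_of_dotProduct_le (norm_nonneg _) fun v => by
        rw [← Matrix.mulVec_mulVec, hMdef, opNorm_mul_transpose_self]
        refine (mulVec_dotProduct_self_le _ _).trans (le_of_eq ?_)
        rw [lowRankFactor_mulVec_dotProduct_self hr hE.orthonormal]
    refine le_of_sq_le_sq (h1.trans ((le_max_right 1 _).trans ?_)) (by positivity)
    exact le_self_pow₀ (le_max_left _ _) two_ne_zero
  -- With m > 0 the invertible matrices M and M⁻¹ are nonzero, so their norms are positive.
  have : Nonempty (Fin m) := ⟨⟨0, hm⟩⟩
  have hM0 : 0 < ‖M‖ := norm_pos_iff.2 hM.isUnit.ne_zero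
  have hMi0 : 0 < ‖M⁻¹‖ := norm_pos_iff.2 hM.inv.isUnit.ne_zero
  have hfin := condNumber_arith (norm_nonneg (augmentedMatrix hr Ac G V w τ)⁻¹)
    (le_max_left 1 ‖M‖) (le_max_left 1 ‖M⁻¹‖) hγmin hγ hl1 ((one_le_inv₀ hδ).2 he1) hχ
    (hcent.one_le_χ₁ (by omega))
    (N := ‖augmentedMatrix hr Ac G V w τ‖) (C := 13 * χ₂ ^ 2 / d₀)
    (hnorm.trans ?_) (hest.2.trans ?_) ?_
  · rw [← scaleFactor_mul_condNumber hM0 hMi0, ← mul_assoc (24 * 851968 : ℝ)] at hfin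
    exact hfin
  · have : γmax * ‖M‖ ≤ γmax * max 1 ‖M‖ :=
      mul_le_mul_of_nonneg_left (le_max_right _ _) hγmax.le
    linarith
  · have : ‖M⁻¹‖ ≤ max 1 ‖M⁻¹‖ := le_max_right _ _
    have h2 : ‖M⁻¹‖ * γmin⁻¹ ≤ max 1 ‖M⁻¹‖ * γmin⁻¹ :=
      mul_le_mul_of_nonneg_right this (by positivity)
    linarith
  -- 851968 = 13 · 256².
  · rw [hd₀]; field_simp; norm_num
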